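/- Notation. Let $\mathbb{H}^3=\{x\in\mathbb{R}^4 : \langle x,x\rangle=-1,\ x_4>0\}$ be hyperbolic space, where $\langle x,y\rangle=x_1y_1+x_2y_2+x_3y_3-x_4y_4$, and let $P_{\mathbb{H}^2}=\{x\in\mathbb{H}^3 : x_3=0\}$ be the horizontal totally geodesic plane. A convex polyhedron in $\mathbb{H}^3$ is a locally finite intersection $C$ of (possibly infinitely many) closed half-spaces, such that each two-dimensional face has finitely many vertices; its boundary $P=\partial C$ is a convex polyhedral surface. A Fuchsian group is a discrete group $F$ of orientation-preserving isometries of $\mathbb{H}^3$ that leaves $P_{\mathbb{H}^2}$ invariant and acts on it cocompactly and without fixed points. A convex Fuchsian polyhedron is a pair $(P,F)$ where $F$ is a Fuchsian group and $P$ is a connected convex polyhedral surface, invariant under $F$, such that $P/F$ is compact. A Killing field of $\mathbb{H}^3$ (or of $P_{\mathbb{H}^2}$) is the velocity field of a one-parameter group of isometries. A Fuchsian Killing field is the extension to $\mathbb{H}^3$ of a Killing field $K$ of $P_{\mathbb{H}^2}$ along the geodesics orthogonal to $P_{\mathbb{H}^2}$: at a point $x$ at signed distance $d$ from $P_{\mathbb{H}^2}$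 with orthogonal projection $p$, it is $(dp_d)^{-1}(K(p))$, where $p_d$ is the orthogonal projection onto $P_{\mathbb{H}^2}$ of the surface of points at signed distance $d$ from $P_{\mathbb{H}^2}$. An infinitesimal isometric deformation of $P$ is a vector field $Z$ on $P$ (with values in $T\mathbb{H}^3$) for which there are a triangulation of $P$, obtained by triangulating each face into geodesic triangles without adding vertices, and a Killing field of $\mathbb{H}^3$ for each triangle, such that $Z$ equals this Killing field on the triangle (so the Killing fields of two adjacent triangles agree on their common edge). It is a Fuchsian deformation of $(P,F)$ if for each $f\in F$ there is a Fuchsian Killing field $\vec\rho(f)$ such that $$Z(f(y))=df_y\big(\vec\rho(f)(y)+Z(y)\big)\qquad\text{for all } y\in P.$$ Theorem. Convex Fuchsian polyhedra are Fuchsian infinitesimally rigid: if $(P,F)$ is a convex Fuchsian polyhedron in $\mathbb{H}^3$ and $Z$ is a Fuchsian deformation of $(P,F)$, then there is a Killing field of $\mathbb{H}^3$ whose restriction to $P$ is $Z$. -/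

import Mathlib

/-!
Hyperbolic 3-space as the upper sheet of the hyperboloid in Minkowski 4-space, its isometries and
Killing fields, locally finite convex polyhedra, Fuchsian groups, and infinitesimal isometric
deformations of polyhedral surfaces.
-/

namespace FuchsianPolyhedra

/-- The vector space underlying Minkowski space of dimension 4. The coordinates are `x 0, x 1, x 2`
(space) and `x 3` (time). -/
abbrev V : Type := Fin 4 → ℝ

/-- The Minkowski bilinear form, of signature `(3, 1)`. -/
def mink (x y : V) : ℝ := x 0 * y 0 + x 1 * y 1 + x 2 * y 2 - x 3 * y 3

/-- Hyperbolic 3-space, the upper sheet of the hyperboloid. -/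
def H3 : Set V := {x | mink x x = -1 ∧ 0 < x 3}

/-- The horizontal totally geodesic plane (in the Klein model `x ↦ (x 0, x 1, x 2) / x 3` it is the
horizontal disc through the centre of the unit ball). -/
def PH2 : Set V := {x | x ∈ H3 ∧ x 2 = 0}

/-- The unit normal of the horizontal plane. -/
def e2 : V := Pi.single 2 1

/-- Invertible linear transformations of Minkowski space. -/
abbrev G4 : Type := Matrix.GeneralLinearGroup (Fin 4) ℝ

/-- The linear action on Minkowski space. As the action is linear, the differential of `act f`, at
every point, is `act f` again. -/
def act (f : G4) (x : V) : V := Matrix.mulVec (f : Matrix (Fin 4) (Fin 4) ℝ) x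

/-- Isometries of hyperbolic space: the Lorentz transformations that preserve the upper sheet. -/
def IsIsometryH3 (f : G4) : Prop :=
  (∀ x y, mink (act f x) (act f y) = mink x y) ∧ ∀ x ∈ H3, act f x ∈ H3

/-- Orientation-preserving isometries of hyperbolic space. -/
def IsOrientedIsometryH3 (f : G4) : Prop :=
  IsIsometryH3 f ∧ Matrix.det (f : Matrix (Fin 4) (Fin 4) ℝ) = 1

/-- `K` is, on hyperbolic space, a Killing field: the velocity field of a one-parameter group of
isometries. Only the values of `K` at points of `H3` matter. (Hyperbolic space is complete, so the
local one-parameter group of a Killing field is global.) -/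
def IsKilling (K : V → V) : Prop :=
  ∃ g : ℝ → G4, (∀ t, IsIsometryH3 (g t)) ∧ (∀ s t, g (s + t) = g s * g t) ∧
    ∀ x ∈ H3, HasDerivAt (fun t => act (g t) x) (K x) 0

/-- `k` is, on the horizontal plane, a Killing field of that hyperbolic plane: the velocity field of
a one-parameter group of isometries of the plane. Only the values of `k` at points of `PH2` matter.
(The isometries of the plane are the restrictions of the isometries of `H3` that preserve it.) -/
def IsKillingPH2 (k : V → V) : Prop :=
  ∃ g : ℝ → G4, (∀ t, IsIsometryH3 (g t)) ∧ (∀ t, ∀ x ∈ PH2, act (g t) x ∈ PH2) ∧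
    (∀ s t, g (s + t) = g s * g t) ∧
    ∀ x ∈ PH2, HasDerivAt (fun t => act (g t) x) (k x) 0

/-- The point at signed distance `d` from `u`, for `u` in the horizontal plane, on the geodesic
through `u` orthogonal to this plane. For fixed `d` this is a diffeomorphism from the horizontal
plane onto a surface at constant distance from it, and it is the inverse of the orthogonal
projection of this surface onto the plane. Its differential is the scalar multiplication by
`cosh d`. Every point of `H3` is of this form, for a unique pair `(d, u)`. -/
noncomputable def normalPoint (d : ℝ) (u : V) : V := Real.cosh d • u + Real.sinh d • e2

/-- `L` is a Fuchsian Killing field: a Killing field of the horizontal plane, extended to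
hyperbolic space along the geodesics orthogonal to the plane, by the inverse of the differential of
the orthogonal projection of the equidistant surface to the plane. -/
def IsFuchsianKilling (L : V → V) : Prop :=
  ∃ k : V → V, IsKillingPH2 k ∧
    ∀ u ∈ PH2, ∀ d : ℝ, L (normalPoint d u) = Real.cosh d • k u

/-- A Fuchsian group of hyperbolic space (with the horizontal plane as its invariant plane): a
discrete group of orientation-preserving isometries that leaves the plane invariant and acts on it
cocompactly and without fixed points. -/
structure IsFuchsianGroup (F : Subgroup G4) : Prop where
  isometry : ∀ f ∈ F, IsOrientedIsometryH3 f
  discrete : DiscreteTopology F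
  invariant : ∀ f ∈ F, ∀ x ∈ PH2, act f x ∈ PH2
  cocompact : ∃ B : Set V, B ⊆ PH2 ∧ IsCompact B ∧ ∀ x ∈ PH2, ∃ f ∈ F, act f x ∈ B
  free : ∀ f ∈ F, ∀ x ∈ PH2, act f x = x → f = 1

/-- The hyperbolic convex hull of a set of points of `H3`: the radial projection to `H3` of the
linear convex hull. For two points this is the geodesic segment, for three points the geodesic
triangle. -/
def hconv (s : Set V) : Set V := {x | x ∈ H3 ∧ ∃ r : ℝ, 0 < r ∧ r • x ∈ convexHull ℝ s}

/-- A vertex of `C`: a point of `C` that is not an interior point of a geodesic segment in `C`. -/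
def IsVertex (C : Set V) (x : V) : Prop :=
  x ∈ C ∧ ∀ a ∈ C, ∀ b ∈ C, x ∈ hconv {a, b} → x = a ∨ x = b

/-- A face of `C`: the intersection of `C` with a supporting plane, if it has dimension two (that
is, if it spans a linear space of dimension three). -/
def IsFace (C G : Set V) : Prop :=
  ∃ n : V, 0 < mink n n ∧ (∀ x ∈ C, mink n x ≤ 0) ∧ G = {x | x ∈ C ∧ mink n x = 0} ∧
    Module.finrank ℝ (Submodule.span ℝ G) = 3

/-- A convex polyhedron: a (possibly infinite) intersection of closed half-spaces of `H3` that is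
locally finite. Near each point of `C` finitely many of the half-spaces cut out `C` (so that only
finitely many edges meet at a vertex), and each face has a finite number of vertices. -/
def IsConvexPolyhedron (C : Set V) : Prop :=
  (∃ N : Set V, (∀ n ∈ N, 0 < mink n n) ∧ C = {x | x ∈ H3 ∧ ∀ n ∈ N, mink n x ≤ 0} ∧
    ∀ x ∈ C, ∃ U ∈ nhds x, ∃ N₀ ⊆ N, N₀.Finite ∧
      ∀ y ∈ U, y ∈ H3 → (y ∈ C ↔ ∀ n ∈ N₀, mink n y ≤ 0)) ∧
  ∀ G, IsFace C G → {x | x ∈ G ∧ IsVertex C x}.Finite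

/-- The boundary of the closed set `C` in hyperbolic space. -/
def boundary (C : Set V) : Set V := C ∩ closure (H3 \ C)

/-- The pair of the surface `boundary C` and the group `F` is a convex Fuchsian polyhedron: the
surface is a (connected) convex polyhedral surface, invariant under the Fuchsian group `F`, and its
quotient by `F` is a compact surface. -/
structure IsConvexFuchsianPolyhedron (C : Set V) (F : Subgroup G4) : Prop where
  polyhedron : IsConvexPolyhedron C
  connected : IsConnected (boundary C)
  group : IsFuchsianGroup F
  invariant : ∀ f ∈ F, act f '' boundary C = boundary C
  cocompact : ∃ B : Set V, B ⊆ boundary C ∧ IsCompact B ∧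
    ∀ x ∈ boundary C, ∃ f ∈ F, act f x ∈ B

/-- `T` is a triangulation of the polyhedral surface `boundary C`, given by a triangulation of each
face of `C`, without new vertices. A triangle is represented by the set of its three vertices. -/
structure IsTriangulation (C : Set V) (T : Set (Set V)) : Prop where
  three : ∀ t ∈ T, t.ncard = 3
  nondegenerate : ∀ t ∈ T, LinearIndepOn ℝ id t
  vertices : ∀ t ∈ T, ∀ x ∈ t, IsVertex C x
  in_face : ∀ t ∈ T, ∃ G, IsFace C G ∧ hconv t ⊆ G
  cover : ∀ G, IsFace C G → ∀ x ∈ G, ∃ t ∈ T, hconv t ⊆ G ∧ x ∈ hconv t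
  inter : ∀ t ∈ T, ∀ t' ∈ T, hconv t ∩ hconv t' = hconv (t ∩ t')

/-- `Z` is an infinitesimal isometric deformation of the polyhedral surface `boundary C`: a field
on the surface that is a Killing field on each triangle of a triangulation. The Killing fields on
adjacent triangles agree on the common edge, where both are equal to `Z`. -/
def IsInfinitesimalIsometricDeformation (C : Set V) (Z : V → V) : Prop :=
  ∃ T : Set (Set V), IsTriangulation C T ∧
    ∃ K : Set V → V → V, (∀ t ∈ T, IsKilling (K t)) ∧ ∀ t ∈ T, ∀ x ∈ hconv t, Z x = K t x

/-- `Z` is a Fuchsian deformation: an infinitesimal isometric deformation that is equivariant up to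
Fuchsian Killing fields, `Z (f y) = df (L f + Z) (y)`. -/
def IsFuchsianDeformation (C : Set V) (F : Subgroup G4) (Z : V → V) : Prop :=
  IsInfinitesimalIsometricDeformation C Z ∧
    ∃ L : F → V → V, (∀ f, IsFuchsianKilling (L f)) ∧
      ∀ f : F, ∀ y ∈ boundary C, Z (act f y) = act f (L f y + Z y)

/-- `Z` is trivial: on the surface it is the restriction of a Killing field of hyperbolic space. -/
def IsTrivialDeformation (C : Set V) (Z : V → V) : Prop :=
  ∃ K : V → V, IsKilling K ∧ ∀ x ∈ boundary C, Z x = K x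

/-- Fuchsian infinitesimal rigidity: all Fuchsian deformations are trivial. -/
def IsFuchsianInfinitesimallyRigid (C : Set V) (F : Subgroup G4) : Prop :=
  ∀ Z : V → V, IsFuchsianDeformation C F Z → IsTrivialDeformation C Z

end FuchsianPolyhedra

namespace FuchsianPolyhedra

open Filter Topology

/-! ### The Minkowski form -/

/-! The argument is a maximum principle for the vertical component, carried out on the cone over the
surface in Minkowski space. The degree-one extension `W x = len x • Z (nrm x)` is a linear skew map
on the cone over each triangle, so adding a Killing field means adding a skew map.

A half-space containing an orbit of the group contains the horizontal plane
(`IsFuchsianGroup.mink_nonpos`). Hence the surface is a concave graph in a vertical direction `e`,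
at bounded distance from the plane (`exists_isGraph`). Fuchsian Killing fields are horizontal, so
the ratio of `|W x 2|` to `len (hor x)` is invariant under the group, and by cocompactness it has a
maximum `m` (`vertical_eq_zero`).

Suppose `m > 0`, attained at `v` over a point `u` of the horizontal plane. The infinitesimal boost
`m • wedge e u` has vertical component `-m * mink x u`, which by the reverse Cauchy–Schwarz
inequality is at least `m * len (hor x)`, with equality only on the ray over `u`. Subtracting it,
and then a horizontal Killing field, gives a deformation that vanishes at `v` and whose vertical
component is negative off the ray of `v` (`false_of_max`). Piecewise linearity forces `v` to lie on
the ray of a vertex.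

Around this vertex the surface is a closed curve `circ + φ e` moved by `z`. Formally, the integral
of `⟨z, e⟩ (φ'' + φ)` over the circle vanishes, because `z` is skew in `y` on each sector. But `φ''
+ φ ≤ 0` by concavity, with negative total mass because the point is a vertex, while `⟨z, e⟩ < 0`: a
contradiction. The file proves this by a discrete summation by parts on a regular subdivision, where
the few steps that leave a sector contribute too little (`false_of_neg`, `false_of_strict_max`).

So the vertical component vanishes. Then every triangle's skew map kills `e`, the deformation
descends to the horizontal cone, and preservation of the velocity component along straight segments
identifies it with a single skew map (`eq_of_horizontal`). -/

theorem mink_comm (x y : V) : mink x y = mink y x := by simp only [mink]; ring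

theorem mink_add_left (x y z : V) : mink (x + y) z = mink x z + mink y z := by
  simp only [mink, Pi.add_apply]; ring

theorem mink_add_right (x y z : V) : mink x (y + z) = mink x y + mink x z := by
  simp only [mink, Pi.add_apply]; ring

theorem mink_sub_left (x y z : V) : mink (x - y) z = mink x z - mink y z := by
  simp only [mink, Pi.sub_apply]; ring

theorem mink_sub_right (x y z : V) : mink x (y - z) = mink x y - mink x z := by
  simp only [mink, Pi.sub_apply]; ring

theorem mink_smul_left (c : ℝ) (x y : V) : mink (c • x) y = c * mink x y := by
  simp only [mink, Pi.smul_apply, smul_eq_mul]; ring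

theorem mink_smul_right (c : ℝ) (x y : V) : mink x (c • y) = c * mink x y := by
  simp only [mink, Pi.smul_apply, smul_eq_mul]; ring

theorem mink_neg_left (x y : V) : mink (-x) y = -mink x y := by
  simp only [mink, Pi.neg_apply]; ring

theorem mink_neg_right (x y : V) : mink x (-y) = -mink x y := by
  simp only [mink, Pi.neg_apply]; ring

@[simp] theorem mink_zero_left (y : V) : mink 0 y = 0 := by simp [mink]

@[simp] theorem mink_zero_right (y : V) : mink y 0 = 0 := by simp [mink]

theorem mink_e2_right (x : V) : mink x e2 = x 2 := by simp [mink, e2]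

theorem mink_e2_left (x : V) : mink e2 x = x 2 := by simp [mink, e2]

@[simp] theorem e2_two : e2 2 = 1 := by simp [e2]

theorem mink_e2_e2 : mink e2 e2 = 1 := by simp [mink, e2]

@[fun_prop] theorem continuous_mink {X : Type*} [TopologicalSpace X] {f g : X → V}
    (hf : Continuous f) (hg : Continuous g) : Continuous fun x => mink (f x) (g x) := by
  unfold mink; fun_prop

@[fun_prop] theorem continuousAt_mink {X : Type*} [TopologicalSpace X] {f g : X → V} {x : X}
    (hf : ContinuousAt f x) (hg : ContinuousAt g x) :
    ContinuousAt (fun x => mink (f x) (g x)) x :=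
  (continuous_mink continuous_fst continuous_snd).continuousAt.comp (hf.prodMk hg)

/-- The Minkowski form as a linear functional of its second argument. -/
def minkL (n : V) : V →ₗ[ℝ] ℝ where
  toFun := mink n
  map_add' := mink_add_right n
  map_smul' c x := by simp [mink_smul_right]

@[simp] theorem minkL_apply (n x : V) : minkL n x = mink n x := rfl

theorem eq_zero_of_mink_eq_zero {z : V} (h : ∀ x, mink z x = 0) : z = 0 := by
  have h0 := h (Pi.single 0 1)
  have h1 := h (Pi.single 1 1)
  have h2 := h (Pi.single 2 1)
  have h3 := h (Pi.single 3 1)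
  simp [mink] at h0 h1 h2 h3
  ext i; fin_cases i <;> simp [*]

theorem mink_eq_zero_of_mem_span {z : V} {s : Set V} (h : ∀ x ∈ s, mink z x = 0) {x : V}
    (hx : x ∈ Submodule.span ℝ s) : mink z x = 0 := by
  have : Submodule.span ℝ s ≤ LinearMap.ker (minkL z) :=
    Submodule.span_le.2 h
  simpa using this hx

theorem eq_zero_of_mink_eq_zero_of_span {z : V} {s : Set V} (hs : Submodule.span ℝ s = ⊤)
    (h : ∀ x ∈ s, mink z x = 0) : z = 0 :=
  eq_zero_of_mink_eq_zero fun _ => mink_eq_zero_of_mem_span h (hs ▸ Submodule.mem_top)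

/-- A vector orthogonal to a timelike vector is spacelike or zero. -/
theorem eq_zero_or_pos_of_orthogonal {u r : V} (hu : mink u u < 0) (h : mink r u = 0) :
    r = 0 ∨ 0 < mink r r := by
  by_cases hr : r 0 = 0 ∧ r 1 = 0 ∧ r 2 = 0
  · obtain ⟨h0, h1, h2⟩ := hr
    left
    have hu3 : u 3 ≠ 0 := by
      intro h3; simp only [mink, h3] at hu
      nlinarith [mul_self_nonneg (u 0), mul_self_nonneg (u 1), mul_self_nonneg (u 2)]
    have : r 3 = 0 := by
      simp only [mink, h0, h1, h2] at h
      have : r 3 * u 3 = 0 := by linarith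
      exact (mul_eq_zero.1 this).resolve_right hu3
    ext i; fin_cases i <;> simp [*]
  · right
    have hpos : 0 < r 0 * r 0 + r 1 * r 1 + r 2 * r 2 := by
      by_contra hn
      apply hr
      refine ⟨?_, ?_, ?_⟩ <;> apply mul_self_eq_zero.1 <;>
        nlinarith [mul_self_nonneg (r 0), mul_self_nonneg (r 1), mul_self_nonneg (r 2)]
    simp only [mink] at hu h ⊢
    have hu3 : 0 < u 3 * u 3 := by
      nlinarith [mul_self_nonneg (u 0), mul_self_nonneg (u 1), mul_self_nonneg (u 2)]
    have h3 : r 3 * u 3 = r 0 * u 0 + r 1 * u 1 + r 2 * u 2 := by linarith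
    have cs : (r 0 * u 0 + r 1 * u 1 + r 2 * u 2) ^ 2 ≤
        (r 0 * r 0 + r 1 * r 1 + r 2 * r 2) * (u 0 * u 0 + u 1 * u 1 + u 2 * u 2) := by
      nlinarith [sq_nonneg (r 0 * u 1 - r 1 * u 0), sq_nonneg (r 0 * u 2 - r 2 * u 0),
        sq_nonneg (r 1 * u 2 - r 2 * u 1)]
    have hlt : (r 0 * r 0 + r 1 * r 1 + r 2 * r 2) * (u 0 * u 0 + u 1 * u 1 + u 2 * u 2) <
        (r 0 * r 0 + r 1 * r 1 + r 2 * r 2) * (u 3 * u 3) :=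
      mul_lt_mul_of_pos_left (by linarith) hpos
    rw [← h3] at cs
    have : (r 3 * r 3) * (u 3 * u 3) < (r 0 * r 0 + r 1 * r 1 + r 2 * r 2) * (u 3 * u 3) := by
      nlinarith
    have := lt_of_mul_lt_mul_right this hu3.le
    linarith

/-! ### The future timelike cone -/

/-- The open cone of future timelike vectors. -/
def TL : Set V := {x | mink x x < 0 ∧ 0 < x 3}

theorem H3_subset_TL : H3 ⊆ TL := fun x hx => ⟨by rw [hx.1]; norm_num, hx.2⟩

theorem isOpen_TL : IsOpen TL := by
  apply IsOpen.inter
  · exact isOpen_lt (f := fun x : V => mink x x) (by fun_prop) continuous_const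
  · exact isOpen_lt (g := fun x : V => x 3) continuous_const (by fun_prop)

theorem mink_neg_of_mem_TL {x y : V} (hx : x ∈ TL) (hy : y ∈ TL) : mink x y < 0 := by
  by_contra hn
  push Not at hn
  obtain ⟨hx1, hx2⟩ := hx
  obtain ⟨hy1, hy2⟩ := hy
  simp only [mink] at *
  have hp : 0 < x 3 * y 3 := mul_pos hx2 hy2
  have cs : (x 0 * y 0 + x 1 * y 1 + x 2 * y 2) ^ 2 ≤
      (x 0 * x 0 + x 1 * x 1 + x 2 * x 2) * (y 0 * y 0 + y 1 * y 1 + y 2 * y 2) := by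
    nlinarith [sq_nonneg (x 0 * y 1 - x 1 * y 0), sq_nonneg (x 0 * y 2 - x 2 * y 0),
      sq_nonneg (x 1 * y 2 - x 2 * y 1)]
  have h1 : (x 3 * y 3) ^ 2 ≤ (x 0 * y 0 + x 1 * y 1 + x 2 * y 2) ^ 2 :=
    pow_le_pow_left₀ hp.le (by linarith) 2
  have h2 : (x 0 * x 0 + x 1 * x 1 + x 2 * x 2) * (y 0 * y 0 + y 1 * y 1 + y 2 * y 2) <
      (x 3 * x 3) * (y 3 * y 3) := by
    apply mul_lt_mul'' (by linarith) (by linarith) <;>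
      linarith [mul_self_nonneg (x 0), mul_self_nonneg (x 1), mul_self_nonneg (x 2),
        mul_self_nonneg (y 0), mul_self_nonneg (y 1), mul_self_nonneg (y 2)]
  nlinarith

theorem TL_add {x y : V} (hx : x ∈ TL) (hy : y ∈ TL) : x + y ∈ TL := by
  refine ⟨?_, add_pos hx.2 hy.2⟩
  have := mink_neg_of_mem_TL hx hy
  have h1 := hx.1
  have h2 := hy.1
  rw [mink_add_left, mink_add_right, mink_add_right, mink_comm y x]
  linarith

theorem TL_smul {x : V} (hx : x ∈ TL) {c : ℝ} (hc : 0 < c) : c • x ∈ TL := by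
  refine ⟨?_, by simpa using mul_pos hc hx.2⟩
  rw [mink_smul_left, mink_smul_right]
  have := hx.1
  exact mul_neg_of_pos_of_neg hc (mul_neg_of_pos_of_neg hc this)

theorem convex_TL : Convex ℝ TL := by
  refine convex_iff_forall_pos.2 fun x hx y hy a b ha hb _ => ?_
  exact TL_add (TL_smul hx ha) (TL_smul hy hb)

/-- The orthogonal projection along `e2`. -/
def hor (x : V) : V := x - x 2 • e2

@[simp] theorem hor_two (x : V) : hor x 2 = 0 := by simp [hor]

theorem hor_add_vert (x : V) : hor x + x 2 • e2 = x := by simp [hor]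

theorem hor_add (x y : V) : hor (x + y) = hor x + hor y := by
  simp only [hor, Pi.add_apply, add_smul]; abel

theorem hor_smul (c : ℝ) (x : V) : hor (c • x) = c • hor x := by
  simp only [hor, Pi.smul_apply, smul_eq_mul, mul_smul, smul_sub]

@[simp] theorem hor_e2 : hor e2 = 0 := by simp [hor]

theorem hor_of_two_eq_zero {x : V} (h : x 2 = 0) : hor x = x := by simp [hor, h]

@[simp] theorem hor_hor (x : V) : hor (hor x) = hor x := hor_of_two_eq_zero (by simp)

@[fun_prop] theorem continuous_hor : Continuous hor := by unfold hor; fun_prop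

theorem mink_hor_hor (x : V) : mink (hor x) (hor x) = mink x x - x 2 ^ 2 := by
  simp [hor, mink, e2]; ring

theorem mink_hor_left (x y : V) (hy : y 2 = 0) : mink (hor x) y = mink x y := by
  simp [hor, mink, e2, hy]

theorem hor_mem_TL {x : V} (hx : x ∈ TL) : hor x ∈ TL := by
  refine ⟨?_, by simpa [hor, e2] using hx.2⟩
  rw [mink_hor_hor]
  nlinarith [hx.1, sq_nonneg (x 2)]

/-- The Minkowski length of a timelike vector. -/
noncomputable def len (x : V) : ℝ := √(-mink x x)

theorem len_pos {x : V} (hx : x ∈ TL) : 0 < len x := Real.sqrt_pos.2 (by linarith [hx.1])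

theorem len_sq {x : V} (hx : x ∈ TL) : len x ^ 2 = -mink x x :=
  Real.sq_sqrt (by linarith [hx.1])

theorem len_smul {c : ℝ} (hc : 0 ≤ c) (x : V) : len (c • x) = c * len x := by
  unfold len
  rw [mink_smul_left, mink_smul_right,
    show -(c * (c * mink x x)) = c ^ 2 * (-mink x x) by ring, Real.sqrt_mul (sq_nonneg c),
    Real.sqrt_sq hc]

@[fun_prop] theorem continuous_len : Continuous len := by unfold len; fun_prop

theorem len_eq_one {x : V} (hx : x ∈ H3) : len x = 1 := by simp [len, hx.1]

/-- The radial projection of the timelike cone to hyperbolic space. -/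
noncomputable def nrm (x : V) : V := (len x)⁻¹ • x

theorem nrm_mem_H3 {x : V} (hx : x ∈ TL) : nrm x ∈ H3 := by
  have hl := len_pos hx
  refine ⟨?_, (TL_smul hx (inv_pos.2 hl)).2⟩
  rw [nrm, mink_smul_left, mink_smul_right, show mink x x = -len x ^ 2 by rw [len_sq hx]; ring]
  field_simp

theorem nrm_of_mem_H3 {x : V} (hx : x ∈ H3) : nrm x = x := by simp [nrm, len_eq_one hx]

theorem nrm_smul {c : ℝ} (hc : 0 < c) (x : V) : nrm (c • x) = nrm x := by
  rw [nrm, nrm, len_smul hc.le, smul_smul, mul_inv, mul_comm c⁻¹, mul_assoc,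
    inv_mul_cancel₀ hc.ne', mul_one]

theorem len_smul_nrm {x : V} (hx : x ∈ TL) : len x • nrm x = x := by
  rw [nrm, smul_smul, mul_inv_cancel₀ (len_pos hx).ne', one_smul]

theorem continuousAt_nrm {x : V} (hx : x ∈ TL) : ContinuousAt nrm x := by
  unfold nrm
  have := (len_pos hx).ne'
  fun_prop (disch := assumption)

/-- The reverse Cauchy–Schwarz inequality. -/
theorem len_le_neg_mink {u q : V} (hu : u ∈ TL) (hu1 : mink u u = -1) (hq : q ∈ TL) :
    len q ≤ -mink q u ∧ (len q = -mink q u → q = (-mink q u) • u) := by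
  set r := q + mink q u • u with hr
  have horth : mink r u = 0 := by
    rw [hr, mink_add_left, mink_smul_left, hu1]; ring
  have hrr : mink r r = mink q q + mink q u ^ 2 := by
    rw [hr, mink_add_left, mink_add_right, mink_add_right, mink_smul_left, mink_smul_left,
      mink_smul_right, mink_smul_right, hu1, mink_comm u q]
    ring
  have hneg := mink_neg_of_mem_TL hq hu
  have hl := len_pos hq
  have hl2 := len_sq hq
  rcases eq_zero_or_pos_of_orthogonal hu.1 horth with h0 | h0
  · have : q = (-mink q u) • u := by
      rw [neg_smul]; exact eq_neg_of_add_eq_zero_left (hr ▸ h0)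
    refine ⟨?_, fun _ => this⟩
    rw [h0] at hrr
    simp only [mink_zero_left] at hrr
    exact abs_le_of_sq_le_sq' (by nlinarith) (by linarith) |>.2
  · have : len q < -mink q u := by
      apply lt_of_pow_lt_pow_left₀ 2 (by linarith)
      nlinarith
    exact ⟨this.le, fun h => absurd h this.ne⟩

/-! ### Skew maps and Killing fields -/

/-- Infinitesimal isometries of Minkowski space. -/
def Skew (A : V →ₗ[ℝ] V) : Prop := ∀ x y, mink (A x) y = -mink x (A y)

theorem Skew.self {A : V →ₗ[ℝ] V} (h : Skew A) (x : V) : mink (A x) x = 0 := by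
  have := h x x
  rw [mink_comm x] at this
  linarith

theorem Skew.sub {A B : V →ₗ[ℝ] V} (hA : Skew A) (hB : Skew B) : Skew (A - B) := fun x y => by
  simp only [LinearMap.sub_apply, mink_sub_left, mink_sub_right, hA x y, hB x y]; ring

theorem Skew.smul {A : V →ₗ[ℝ] V} (hA : Skew A) (c : ℝ) : Skew (c • A) := fun x y => by
  simp only [LinearMap.smul_apply, mink_smul_left, mink_smul_right, hA x y]; ring

/-- The elementary infinitesimal isometry of the plane of two vectors. -/
def wedge (a b : V) : V →ₗ[ℝ] V where
  toFun x := mink x a • b - mink x b • a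
  map_add' x y := by simp only [mink_add_left, add_smul]; abel
  map_smul' c x := by simp only [mink_smul_left, mul_smul, smul_sub, RingHom.id_apply]

theorem wedge_apply (a b x : V) : wedge a b x = mink x a • b - mink x b • a := rfl

theorem skew_wedge (a b : V) : Skew (wedge a b) := fun x y => by
  rw [mink_comm x]
  simp only [wedge_apply, mink_sub_left, mink_smul_left, mink_comm x, mink_comm y]
  ring

/-- `TL` is open and consists of positive multiples of points of `H3`, so any vector is a rescaled
difference of two elements of `TL`. -/
theorem span_H3 : Submodule.span ℝ H3 = ⊤ := by
  have key : ∀ x : V, x ∈ TL → x ∈ Submodule.span ℝ H3 := fun x hx => by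
    rw [← len_smul_nrm hx]
    exact Submodule.smul_mem _ _ (Submodule.subset_span (nrm_mem_H3 hx))
  have h0 : (Pi.single 3 1 : V) ∈ TL := by constructor <;> simp [mink]
  rw [eq_top_iff]
  rintro x -
  have hev : ∀ᶠ s : ℝ in 𝓝 0, (Pi.single 3 1 : V) + s • x ∈ TL := by
    have hc : ContinuousAt (fun s : ℝ => (Pi.single 3 1 : V) + s • x) 0 := by fun_prop
    exact hc.eventually (isOpen_TL.mem_nhds (by simpa using h0))
  obtain ⟨s, hs, hs0⟩ := ((hev.filter_mono nhdsWithin_le_nhds).and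
    (self_mem_nhdsWithin : ∀ᶠ s : ℝ in 𝓝[>] 0, s ∈ Set.Ioi 0)).exists
  have : x = s⁻¹ • (((Pi.single 3 1 : V) + s • x) - Pi.single 3 1) := by
    rw [add_sub_cancel_left, smul_smul, inv_mul_cancel₀ (ne_of_gt hs0), one_smul]
  rw [this]
  exact Submodule.smul_mem _ _ (Submodule.sub_mem _ (key _ hs) (key _ h0))

theorem act_add (f : G4) (x y : V) : act f (x + y) = act f x + act f y := Matrix.mulVec_add _ _ _

theorem act_smul (f : G4) (c : ℝ) (x : V) : act f (c • x) = c • act f x := Matrix.mulVec_smul _ _ _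

@[simp] theorem act_one (x : V) : act 1 x = x := by simp [act]

theorem act_mul (f g : G4) (x : V) : act (f * g) x = act f (act g x) := by simp [act]

theorem act_act_inv (f : G4) (x : V) : act f (act f⁻¹ x) = x := by
  rw [← act_mul, mul_inv_cancel, act_one]

/-- Differentiability at time zero is known on `H3` and extends to its span, which is everything.
Skewness is the derivative of the invariance of the form. -/
theorem IsKilling.exists_skew {K : V → V} (hK : IsKilling K) :
    ∃ A : V →ₗ[ℝ] V, Skew A ∧ ∀ x ∈ H3, K x = A x := by
  obtain ⟨g, hg, hmul, hder⟩ := hK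
  have h1 : g 0 = 1 := by
    have := hmul 0 0
    rw [add_zero] at this
    exact left_eq_mul.1 this
  have hdiff : ∀ x, DifferentiableAt ℝ (fun t => act (g t) x) 0 := fun x => by
    have hx : x ∈ Submodule.span ℝ H3 := span_H3 ▸ Submodule.mem_top
    induction hx using Submodule.span_induction with
    | mem x hx => exact (hder x hx).differentiableAt
    | zero =>
      have : (fun t => act (g t) (0 : V)) = fun _ => 0 := by
        funext t; simp [act]
      rw [this]; exact differentiableAt_const _
    | add x y _ _ hx hy => simp only [act_add]; exact hx.add hy
    | smul c x _ hx => simp only [act_smul]; exact hx.const_smul c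
  let A : V →ₗ[ℝ] V :=
    { toFun := fun x => deriv (fun t => act (g t) x) 0
      map_add' := fun x y => by
        simp only [act_add]
        exact deriv_add (hdiff x) (hdiff y)
      map_smul' := fun c x => by
        simp only [act_smul]
        exact deriv_const_smul c (hdiff x) }
  refine ⟨A, fun x y => ?_, fun x hx => (hder x hx).deriv.symm⟩
  have hx := hasDerivAt_pi.1 (hdiff x).hasDerivAt
  have hy := hasDerivAt_pi.1 (hdiff y).hasDerivAt
  have hd := ((((hx 0).mul (hy 0)).add ((hx 1).mul (hy 1))).add ((hx 2).mul (hy 2))).sub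
    ((hx 3).mul (hy 3))
  have hc : HasDerivAt (fun t => mink (act (g t) x) (act (g t) y)) 0 0 := by
    have : (fun t => mink (act (g t) x) (act (g t) y)) = fun _ => mink x y :=
      funext fun t => (hg t).1 x y
    rw [this]; exact hasDerivAt_const _ _
  have := hd.unique hc
  simp only [h1, act_one] at this
  change mink (deriv (fun t => act (g t) x) 0) y = -mink x (deriv (fun t => act (g t) y) 0)
  simp only [mink]
  linarith

/-- A flow that preserves the plane has horizontal velocity on it, and the extension along normals
only rescales by `cosh d`. This is the only property of Fuchsian Killing fields that the proof uses.
-/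
theorem IsFuchsianKilling.two_eq_zero {L : V → V} (hL : IsFuchsianKilling L) {y : V}
    (hy : y ∈ H3) : L y 2 = 0 := by
  obtain ⟨k, ⟨g, -, hinv, -, hder⟩, hLk⟩ := hL
  have hk : ∀ u ∈ PH2, k u 2 = 0 := fun u hu => by
    have h1 := hasDerivAt_pi.1 (hder u hu) 2
    have h2 : (fun t => act (g t) u 2) = fun _ => 0 := funext fun t => (hinv t u hu).2
    rw [h2] at h1
    exact h1.unique (hasDerivAt_const _ _)
  set d := Real.arsinh (y 2) with hd
  have hc := Real.cosh_pos d
  have hs : Real.sinh d = y 2 := Real.sinh_arsinh _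
  set u := (Real.cosh d)⁻¹ • hor y with hu
  have hmem : u ∈ PH2 := by
    refine ⟨⟨?_, (TL_smul (hor_mem_TL (H3_subset_TL hy)) (inv_pos.2 hc)).2⟩, by simp [hu]⟩
    have := Real.cosh_sq d
    rw [hs] at this
    rw [hu, mink_smul_left, mink_smul_right, mink_hor_hor, hy.1,
      show -1 - y 2 ^ 2 = -Real.cosh d ^ 2 by rw [this]; ring]
    field_simp
  have : normalPoint d u = y := by
    rw [normalPoint, hu, smul_smul, mul_inv_cancel₀ hc.ne', one_smul, hs, hor_add_vert]
  rw [← this, hLk u hmem d]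
  simp [hk u hmem]

/-! ### The cone over a convex polyhedron -/

/-- The cone over the intersection of the half-spaces with outward normals in `N`. -/
def Chat (N : Set V) : Set V := {x | x ∈ TL ∧ ∀ n ∈ N, mink n x ≤ 0}

/-- The cone over the boundary of this intersection. -/
def Phat (N : Set V) : Set V := {x | x ∈ Chat N ∧ ∃ n ∈ N, mink n x = 0}

/-- Near each of its points, the cone is cut out by finitely many half-spaces, all of which contain
the point on their boundary. -/
def IsLocallyCut (N : Set V) : Prop := ∀ x ∈ Chat N, ∃ N₁ ⊆ N, N₁.Finite ∧
  (∀ n ∈ N₁, mink n x = 0) ∧ ∀ᶠ y in 𝓝 x, (∀ n ∈ N₁, mink n y ≤ 0) → y ∈ Chat N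

theorem Chat_smul {N : Set V} {x : V} (hx : x ∈ Chat N) {c : ℝ} (hc : 0 < c) : c • x ∈ Chat N :=
  ⟨TL_smul hx.1 hc, fun n hn => by
    rw [mink_smul_right]; exact mul_nonpos_of_nonneg_of_nonpos hc.le (hx.2 n hn)⟩

theorem Phat_smul {N : Set V} {x : V} (hx : x ∈ Phat N) {c : ℝ} (hc : 0 < c) : c • x ∈ Phat N := by
  obtain ⟨h, n, hn, h0⟩ := hx
  exact ⟨Chat_smul h hc, n, hn, by rw [mink_smul_right, h0, mul_zero]⟩

theorem Chat_add {N : Set V} {x y : V} (hx : x ∈ Chat N) (hy : y ∈ Chat N) : x + y ∈ Chat N :=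
  ⟨TL_add hx.1 hy.1, fun n hn => by
    rw [mink_add_right]; exact add_nonpos (hx.2 n hn) (hy.2 n hn)⟩

theorem nrm_mem_Chat {N : Set V} {x : V} (hx : x ∈ Chat N) : nrm x ∈ Chat N :=
  Chat_smul hx (inv_pos.2 (len_pos hx.1))

theorem nrm_mem_Phat {N : Set V} {x : V} (hx : x ∈ Phat N) : nrm x ∈ Phat N :=
  Phat_smul hx (inv_pos.2 (len_pos hx.1.1))

theorem Chat_of_nrm {N : Set V} {x : V} (hx : x ∈ TL) (h : nrm x ∈ Chat N) : x ∈ Chat N := by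
  rw [← len_smul_nrm hx]; exact Chat_smul h (len_pos hx)

theorem eventually_notMem_Chat {N : Set V} {x n : V} (hn : n ∈ N) (h : 0 < mink n x) :
    ∀ᶠ y in 𝓝 x, y ∉ Chat N := by
  have : ContinuousAt (fun y => mink n y) x := by fun_prop
  filter_upwards [this.eventually (lt_mem_nhds h)] with y hy hC
  exact absurd (hC.2 n hn) (not_le.2 hy)

theorem not_eventually_mem_Chat {N : Set V} {x n : V} (hn : n ∈ N) (hpos : 0 < mink n n)
    (h : mink n x = 0) : ¬ ∀ᶠ y in 𝓝 x, y ∈ Chat N := by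
  intro hev
  have hc : ContinuousAt (fun s : ℝ => x + s • n) 0 := by fun_prop
  have hev' := hc.eventually (p := fun y => y ∈ Chat N) (by simpa using hev)
  obtain ⟨s, hs, hs0⟩ := ((hev'.filter_mono nhdsWithin_le_nhds).and
    (self_mem_nhdsWithin : ∀ᶠ s : ℝ in 𝓝[>] 0, s ∈ Set.Ioi 0)).exists
  have := hs.2 n hn
  rw [mink_add_right, h, mink_smul_right, zero_add] at this
  exact absurd this (not_le.2 (mul_pos hs0 hpos))

theorem eventually_mem_Chat {N : Set V} (hN : IsLocallyCut N) {x : V} (hx : x ∈ Chat N)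
    (h : x ∉ Phat N) : ∀ᶠ y in 𝓝 x, y ∈ Chat N := by
  obtain ⟨N₁, hsub, -, hact, hev⟩ := hN x hx
  filter_upwards [hev] with y hy
  refine hy fun n hn => absurd ⟨hx, n, hsub hn, hact n hn⟩ h

/-- Near a point, the boundary is covered by the planes that bound the cone near the point. -/
theorem IsLocallyCut.exists_active {N : Set V} (hN : IsLocallyCut N)
    (hpos : ∀ n ∈ N, 0 < mink n n) {x : V} (hx : x ∈ Chat N) : ∃ N₁ ⊆ N, N₁.Finite ∧
    (∀ n ∈ N₁, mink n x = 0) ∧ (∀ᶠ y in 𝓝 x, (∀ n ∈ N₁, mink n y ≤ 0) → y ∈ Chat N) ∧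
    ∀ᶠ y in 𝓝 x, y ∈ Phat N → ∃ n ∈ N₁, mink n y = 0 := by
  obtain ⟨N₁, hsub, hfin, hact, hev⟩ := hN x hx
  refine ⟨N₁, hsub, hfin, hact, hev, ?_⟩
  filter_upwards [eventually_eventually_nhds.2 hev] with y hy hyP
  by_contra hne
  push Not at hne
  obtain ⟨hyC, n, hn, h0⟩ := hyP
  -- If every active functional were strictly negative at `y`, the cone would contain a
  -- neighbourhood of `y`, which is impossible on a bounding plane.
  refine not_eventually_mem_Chat hn (hpos n hn) h0 ?_
  have : ∀ᶠ z in 𝓝 y, ∀ m ∈ N₁, mink m z < 0 := by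
    rw [eventually_all_finite hfin]
    intro m hm
    have hc : ContinuousAt (fun z => mink m z) y := by fun_prop
    exact hc.eventually (gt_mem_nhds (lt_of_le_of_ne (hyC.2 m (hsub hm)) (hne m hm)))
  filter_upwards [hy, this] with z h1 h2
  exact h1 fun m hm => (h2 m hm).le

/-- The presentation of a polyhedron by the cone over it. -/
structure Presents (N : Set V) (C : Set V) : Prop where
  pos : ∀ n ∈ N, 0 < mink n n
  eq : C = {x | x ∈ H3 ∧ ∀ n ∈ N, mink n x ≤ 0}
  fin : IsLocallyCut N

/-- Local finiteness at `nrm x` passes to the ray of `x` by homogeneity. Half-spaces with `mink n x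
< 0` hold automatically near `x`, so only the active ones are kept. -/
theorem IsConvexPolyhedron.exists_presents {C : Set V} (h : IsConvexPolyhedron C) :
    ∃ N, Presents N C := by
  obtain ⟨⟨N, hpos, hC, hloc⟩, -⟩ := h
  refine ⟨N, hpos, hC, fun x hx => ?_⟩
  have hxC : nrm x ∈ C := by
    rw [hC]; exact ⟨nrm_mem_H3 hx.1, (nrm_mem_Chat hx).2⟩
  obtain ⟨U, hU, N₀, hsub, hfin, hUC⟩ := hloc _ hxC
  refine ⟨{n ∈ N₀ | mink n x = 0}, fun n hn => hsub hn.1, hfin.subset fun n hn => hn.1,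
    fun n hn => hn.2, ?_⟩
  have hne : ∀ᶠ y in 𝓝 x, ∀ n ∈ N₀, mink n x ≠ 0 → mink n y ≤ 0 := by
    rw [eventually_all_finite hfin]
    intro n hn
    by_cases h0 : mink n x = 0
    · simp [h0]
    · have hc : ContinuousAt (fun z => mink n z) x := by fun_prop
      filter_upwards [hc.eventually (gt_mem_nhds (lt_of_le_of_ne (hx.2 n (hsub hn)) h0))] with y hy _
      exact hy.le
  filter_upwards [hne, (continuousAt_nrm hx.1).eventually hU, isOpen_TL.mem_nhds hx.1]
    with y hy hyU hyT hyN
  have : nrm y ∈ C := (hUC _ hyU (nrm_mem_H3 hyT)).2 fun n hn => by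
    rw [nrm, mink_smul_right]
    refine mul_nonpos_of_nonneg_of_nonpos (inv_pos.2 (len_pos hyT)).le ?_
    by_cases h0 : mink n x = 0
    · exact hyN n ⟨hn, h0⟩
    · exact hy n hn h0
  rw [hC] at this
  exact Chat_of_nrm hyT ⟨H3_subset_TL this.1, this.2⟩

section Presents

variable {N C : Set V}

theorem Presents.mem_iff (h : Presents N C) {x : V} : x ∈ C ↔ x ∈ H3 ∧ x ∈ Chat N := by
  constructor
  · intro hx; rw [h.eq] at hx; exact ⟨hx.1, H3_subset_TL hx.1, hx.2⟩
  · rintro ⟨h1, h2⟩; rw [h.eq]; exact ⟨h1, h2.2⟩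

/-- Local finiteness makes a point with no active normal interior. Conversely, pushing a point along
an active normal and projecting back radially leaves `C`. -/
theorem Presents.mem_boundary_iff (h : Presents N C) {x : V} :
    x ∈ boundary C ↔ x ∈ H3 ∧ x ∈ Phat N := by
  constructor
  · rintro ⟨hx, hcl⟩
    obtain ⟨hH, hx⟩ := h.mem_iff.1 hx
    refine ⟨hH, by_contra fun hP => ?_⟩
    have hev := eventually_mem_Chat h.fin hx hP
    obtain ⟨y, hy1, hy2⟩ := (mem_closure_iff_frequently.1 hcl).and_eventually hev |>.exists
    exact hy1.2 (h.mem_iff.2 ⟨hy1.1, hy2⟩)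
  · rintro ⟨hH, hx, n, hn, h0⟩
    refine ⟨h.mem_iff.2 ⟨hH, hx⟩, ?_⟩
    have hc : ContinuousAt (fun s : ℝ => nrm (x + s • n)) 0 := by
      apply ContinuousAt.comp (g := nrm)
      · exact continuousAt_nrm (by simpa using hx.1)
      · fun_prop
    have hT : ContinuousAt (fun s : ℝ => x + s • n) 0 := by fun_prop
    have hTL := hT.eventually (isOpen_TL.mem_nhds (by simpa using hx.1))
    have hlim : Tendsto (fun s : ℝ => nrm (x + s • n)) (𝓝[>] 0) (𝓝 x) := by
      have := hc.tendsto
      simp only [zero_smul, add_zero, nrm_of_mem_H3 hH] at this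
      exact this.mono_left nhdsWithin_le_nhds
    refine mem_closure_of_tendsto hlim ?_
    filter_upwards [hTL.filter_mono nhdsWithin_le_nhds, self_mem_nhdsWithin] with s hs hs0
    refine ⟨nrm_mem_H3 hs, fun hC => ?_⟩
    have := (Chat_of_nrm hs (h.mem_iff.1 hC).2).2 n hn
    rw [mink_add_right, h0, mink_smul_right, zero_add] at this
    exact absurd this (not_le.2 (mul_pos hs0 (h.pos n hn)))

theorem Presents.nrm_mem_boundary (h : Presents N C) {x : V} (hx : x ∈ Phat N) :
    nrm x ∈ boundary C := h.mem_boundary_iff.2 ⟨nrm_mem_H3 hx.1.1, nrm_mem_Phat hx⟩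

theorem Presents.nrm_mem (h : Presents N C) {x : V} (hx : x ∈ Chat N) : nrm x ∈ C :=
  h.mem_iff.2 ⟨nrm_mem_H3 hx.1, nrm_mem_Chat hx⟩

end Presents

/-! ### Fuchsian groups -/

section Fuchsian

variable {F : Subgroup G4} (hF : IsFuchsianGroup F)
include hF

theorem IsFuchsianGroup.mink_act {f : G4} (hf : f ∈ F) (x y : V) :
    mink (act f x) (act f y) = mink x y := (hF.isometry f hf).1.1 x y

theorem IsFuchsianGroup.mink_act_right {f : G4} (hf : f ∈ F) (x y : V) :
    mink x (act f y) = mink (act f⁻¹ x) y := by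
  rw [← hF.mink_act hf (act f⁻¹ x), act_act_inv]

/-- The image of `e2` is orthogonal to the horizontal plane, tested on three independent timelike
vectors. The sign `-1` is kept: an orientation-preserving isometry may exchange the two sides of the
plane. -/
theorem IsFuchsianGroup.act_e2 {f : G4} (hf : f ∈ F) : act f e2 = e2 ∨ act f e2 = -e2 := by
  set z := act f e2 with hz
  have hu : ∀ u ∈ TL, u 2 = 0 → mink z u = 0 := fun u hu hu2 => by
    have hmem : nrm u ∈ PH2 := ⟨nrm_mem_H3 hu, by simp [nrm, hu2]⟩
    have : mink z (nrm u) = 0 := by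
      rw [mink_comm, hz, hF.mink_act_right hf, mink_e2_right]
      exact (hF.invariant _ (F.inv_mem hf) _ hmem).2
    rw [← len_smul_nrm hu, mink_smul_right, this, mul_zero]
  have h3 := hu ![0, 0, 0, 1] (by constructor <;> simp [mink]) (by simp)
  have h0 := hu ![1, 0, 0, 2] (by constructor <;> simp only [mink, Matrix.cons_val] <;> norm_num) (by simp)
  have h1 := hu ![0, 1, 0, 2] (by constructor <;> simp only [mink, Matrix.cons_val] <;> norm_num) (by simp)
  simp only [mink, Matrix.cons_val] at h0 h1 h3
  have hzz : mink z z = 1 := by rw [hz, hF.mink_act hf, mink_e2_e2]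
  clear_value z; clear hu hz
  have e3 : z 3 = 0 := by linarith
  have e0 : z 0 = 0 := by linarith
  have e1 : z 1 = 0 := by linarith
  simp only [mink, e3, e0, e1] at hzz
  have : z 2 = 1 ∨ z 2 = -1 := mul_self_eq_one_iff.1 (by linarith)
  rcases this with h | h
  · left; ext i; fin_cases i <;> simp [e2, *]
  · right; ext i; fin_cases i <;> simp [e2, *]

theorem IsFuchsianGroup.abs_act_two {f : G4} (hf : f ∈ F) (x : V) : |act f x 2| = |x 2| := by
  have h := hF.mink_act hf x e2
  rw [mink_e2_right] at h
  rcases hF.act_e2 hf with h' | h' <;> rw [h'] at h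
  · rw [← h, mink_e2_right]
  · rw [← h, mink_neg_right, mink_e2_right, abs_neg]

end Fuchsian

/-! ### Half-spaces that contain an orbit -/

/-- Positivity at one horizontal timelike vector forces `n 3 < r`, so the functional is positive at
the lightlike vector `(α, β, 0, 1)`. It is therefore unbounded along the geodesic towards that ideal
point. -/
theorem exists_mink_gt {n u : V} (hu : u ∈ TL) (hu2 : u 2 = 0) (h : 0 < mink n u) (R : ℝ) :
    ∃ q ∈ PH2, R < mink n q := by
  obtain ⟨α, β, hαβ, hr⟩ : ∃ α β : ℝ, α ^ 2 + β ^ 2 = 1 ∧ n 0 * α + n 1 * β = √(n 0 ^ 2 + n 1 ^ 2) := by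
    set r := √(n 0 ^ 2 + n 1 ^ 2) with hrd
    have hr2 : r ^ 2 = n 0 ^ 2 + n 1 ^ 2 := Real.sq_sqrt (by positivity)
    by_cases hr : r = 0
    · refine ⟨1, 0, by norm_num, ?_⟩
      rw [hr] at hr2 ⊢
      have : n 0 = 0 := by nlinarith [sq_nonneg (n 0), sq_nonneg (n 1)]
      simp [this]
    · refine ⟨n 0 / r, n 1 / r, ?_, ?_⟩
      · field_simp; linarith
      · field_simp; linarith
  set r := √(n 0 ^ 2 + n 1 ^ 2) with hrd
  have hr0 : 0 ≤ r := Real.sqrt_nonneg _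
  have hr2 : r ^ 2 = n 0 ^ 2 + n 1 ^ 2 := Real.sq_sqrt (by positivity)
  obtain ⟨hu1, hu3⟩ := hu
  have hlt : n 3 < r := by
    by_contra hn
    push Not at hn
    simp only [mink, hu2] at hu1 h
    have h1 : r * u 3 ≤ n 3 * u 3 := mul_le_mul_of_nonneg_right hn hu3.le
    have h2 : (n 0 * u 0 + n 1 * u 1) ^ 2 ≤ (r * u 3) ^ 2 := by
      have : (n 0 * u 0 + n 1 * u 1) ^ 2 ≤ r ^ 2 * (u 0 ^ 2 + u 1 ^ 2) := by
        rw [hr2]; nlinarith [sq_nonneg (n 0 * u 1 - n 1 * u 0)]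
      nlinarith [sq_nonneg r]
    have := abs_le_of_sq_le_sq h2 (by positivity)
    linarith [le_abs_self (n 0 * u 0 + n 1 * u 1)]
  -- Here `s` is the exponential of the distance along the geodesic. The functional takes the value
  -- `((r - n 3) * s - (r + n 3) * s⁻¹) / 2`, and `s` is chosen to make this exceed `|R|`.
  set s : ℝ := 1 + (2 * |R| + |r + n 3|) / (r - n 3) with hs
  have hd : 0 < r - n 3 := by linarith
  have hs1 : 1 ≤ s := by
    rw [hs]; linarith [show 0 ≤ (2 * |R| + |r + n 3|) / (r - n 3) by positivity]
  have hs0 : 0 < s := by linarith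
  refine ⟨![α * ((s - s⁻¹) / 2), β * ((s - s⁻¹) / 2), 0, (s + s⁻¹) / 2], ⟨⟨?_, ?_⟩, ?_⟩, ?_⟩
  · simp only [mink, Matrix.cons_val]
    have : α * ((s - s⁻¹) / 2) * (α * ((s - s⁻¹) / 2)) + β * ((s - s⁻¹) / 2) * (β * ((s - s⁻¹) / 2))
        = ((s - s⁻¹) / 2) ^ 2 := by
      linear_combination ((s - s⁻¹) / 2) ^ 2 * hαβ
    rw [this]; field_simp; ring
  · simp only [Matrix.cons_val]; positivity
  · simp
  · simp only [mink, Matrix.cons_val]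
    have h1 : n 0 * (α * ((s - s⁻¹) / 2)) + n 1 * (β * ((s - s⁻¹) / 2)) + n 2 * 0
        - n 3 * ((s + s⁻¹) / 2) = ((r - n 3) * s - (r + n 3) * s⁻¹) / 2 := by
      linear_combination ((s - s⁻¹) / 2) * hr
    rw [h1]
    have h2 : (r - n 3) * s = (r - n 3) + (2 * |R| + |r + n 3|) := by
      rw [hs]; field_simp
    have h3 : (r + n 3) * s⁻¹ ≤ |r + n 3| := by
      calc (r + n 3) * s⁻¹ ≤ |r + n 3| * s⁻¹ :=
            mul_le_mul_of_nonneg_right (le_abs_self _) (by positivity)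
        _ ≤ |r + n 3| * 1 := mul_le_mul_of_nonneg_left (inv_le_one_of_one_le₀ hs1) (abs_nonneg _)
        _ = _ := mul_one _
    linarith [le_abs_self R]

/-- The sign of the Gram determinant of three vectors, two of them points of the hyperbolic
plane. -/
theorem gram_le {n p q : V} (hp : p ∈ PH2) (hq : q ∈ PH2) :
    mink n q ^ 2 + mink n p ^ 2 + 2 * mink n q * mink n p * mink q p ≤
      (mink n n - n 2 ^ 2) * (mink q p ^ 2 - 1) := by
  have hp1 := hp.1.1
  have hq1 := hq.1.1
  have hp2 := hp.2
  have hq2 := hq.2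
  set D := n 0 * (p 1 * q 3 - p 3 * q 1) - n 1 * (p 0 * q 3 - p 3 * q 0)
    + n 3 * (p 0 * q 1 - p 1 * q 0) with hD
  -- In signature `(2, 1)` the Gram determinant is minus the square of the determinant `D` of the
  -- horizontal parts.
  have key : (mink n n - n 2 ^ 2) * (mink q p ^ 2 - mink q q * mink p p) -
      (-(mink n q ^ 2 * mink p p) - mink n p ^ 2 * mink q q
        + 2 * mink n q * mink n p * mink q p) = D ^ 2 := by
    simp only [mink, hp2, hq2, hD]; ring
  rw [hp1, hq1] at key
  nlinarith [sq_nonneg D]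

/-- A half-space that contains an orbit of the Fuchsian group contains the horizontal plane. -/
theorem IsFuchsianGroup.mink_nonpos {F : Subgroup G4} (hF : IsFuchsianGroup F) {n y : V}
    (hy : y ∈ TL) (horb : ∀ f ∈ F, mink n (act f y) ≤ 0) {u : V} (hu : u ∈ TL) (hu2 : u 2 = 0) :
    mink n u ≤ 0 := by
  by_contra hpos
  push Not at hpos
  set p := nrm (hor y) with hp
  have hpm : p ∈ PH2 := ⟨nrm_mem_H3 (hor_mem_TL hy), by simp [hp, nrm]⟩
  obtain ⟨M, hM0, hM⟩ : ∃ M, 0 ≤ M ∧ ∀ f ∈ F, mink n (act f p) ≤ M := by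
    refine ⟨(len (hor y))⁻¹ * (|y 2| * |n 2|), ?_, fun f hf => ?_⟩
    · have := len_pos (hor_mem_TL hy); positivity
    · rw [hp, nrm, act_smul, mink_smul_right]
      refine mul_le_mul_of_nonneg_left ?_ (inv_pos.2 (len_pos (hor_mem_TL hy))).le
      have h1 : mink n (act f (hor y)) = mink n (act f y) - y 2 * mink n (act f e2) := by
        conv_rhs => rw [← hor_add_vert y]
        simp only [act_add, act_smul, mink_add_right, mink_smul_right, Pi.add_apply, hor_two,
          Pi.smul_apply, e2_two, smul_eq_mul]
        ring
      have h2 : |mink n (act f e2)| = |n 2| := by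
        rcases hF.act_e2 hf with h | h <;> rw [h]
        · rw [mink_e2_right]
        · rw [mink_neg_right, mink_e2_right, abs_neg]
      rw [h1, ← h2, ← abs_mul]
      linarith [horb f hf, neg_abs_le (y 2 * mink n (act f e2))]
  obtain ⟨B, -, hB, hcov⟩ := hF.cocompact
  obtain ⟨D, hD⟩ := (hB.image (f := fun b => -mink b p) (by fun_prop)).bddAbove
  -- With `a` the value of the functional at a far point `q`, and an orbit point of `p` within
  -- bounded distance of `q`, `gram_le` bounds `a ^ 2` by `2 * a * M * D + |ν| * D ^ 2`. This fails
  -- once `a` exceeds `R`.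
  set R := 2 * M * |D| + |mink n n - n 2 ^ 2| * D ^ 2 + 1 with hR
  obtain ⟨q, hq, hqR⟩ := exists_mink_gt hu hu2 hpos R
  obtain ⟨f, hf, hfB⟩ := hcov q hq
  set p' := act f⁻¹ p with hp'
  have hf' := F.inv_mem hf
  have hpm' : p' ∈ PH2 := hF.invariant _ hf' _ hpm
  have hc : -mink q p' ≤ D := by
    rw [hp', hF.mink_act_right hf', inv_inv]
    exact hD ⟨_, hfB, rfl⟩
  have hc1 : 1 ≤ -mink q p' := by
    have := (len_le_neg_mink (H3_subset_TL hpm'.1) hpm'.1.1 (H3_subset_TL hq.1)).1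
    rwa [len_eq_one hq.1] at this
  have hb := hM _ hf'
  have hg := gram_le (n := n) hpm' hq
  set a := mink n q
  set b := mink n (act f⁻¹ p)
  change b ≤ M at hb
  set c := -mink q p'
  have hmq : mink q p' = -c := by simp [c]
  rw [hmq] at hg
  change a ^ 2 + b ^ 2 + 2 * a * b * (-c) ≤ (mink n n - n 2 ^ 2) * ((-c) ^ 2 - 1) at hg
  have hDabs : |D| = D := abs_of_nonneg (by linarith)
  rw [hDabs] at hR
  set ν := mink n n - n 2 ^ 2
  have h1 : ν * ((-c) ^ 2 - 1) ≤ |ν| * D ^ 2 := by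
    calc ν * ((-c) ^ 2 - 1) ≤ |ν| * ((-c) ^ 2 - 1) :=
          mul_le_mul_of_nonneg_right (le_abs_self _) (by nlinarith)
      _ ≤ _ := mul_le_mul_of_nonneg_left (by nlinarith) (abs_nonneg _)
  have hν : 0 ≤ |ν| * D ^ 2 := by positivity
  have hMD : 0 ≤ M * D := mul_nonneg hM0 (by linarith)
  have ha : 1 ≤ a := by nlinarith
  have h2 : b * c ≤ M * D := by
    calc b * c ≤ M * c := mul_le_mul_of_nonneg_right hb (by linarith)
      _ ≤ _ := mul_le_mul_of_nonneg_left hc hM0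
  have h3 : 2 * a * (b * c) ≤ 2 * a * (M * D) := mul_le_mul_of_nonneg_left h2 (by linarith)
  have h4 : a * (2 * M * D + |ν| * D ^ 2 + 1) ≤ a * a :=
    mul_le_mul_of_nonneg_left (by linarith) (by linarith)
  have h5 : |ν| * D ^ 2 ≤ a * (|ν| * D ^ 2) := le_mul_of_one_le_left hν ha
  nlinarith [sq_nonneg b]

/-! ### Boundaries that are graphs over the horizontal plane -/

/-- The boundary of the polyhedral cone lies, with respect to the vertical unit vector `e`, above
the horizontal plane, at bounded distance from it, and it is nowhere vertical. -/
structure IsGraph (N : Set V) (e : V) : Prop where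
  unit : e = e2 ∨ e = -e2
  pos : ∀ n ∈ N, 0 < mink n n
  fin : IsLocallyCut N
  up : ∀ x ∈ Phat N, ∀ n ∈ N, mink n x = 0 → 0 < mink n e
  plane : ∀ n ∈ N, ∀ u ∈ TL, u 2 = 0 → mink n u ≤ 0
  bound : ∃ κ : ℝ, κ < 1 ∧ ∀ x ∈ Phat N, x 2 ^ 2 ≤ κ * -mink (hor x) (hor x)
  nonempty : (Phat N).Nonempty

/-- A vertical unit vector. -/
def IsVertical (e : V) : Prop := e = e2 ∨ e = -e2

theorem IsVertical.hor_eq {e : V} (he : IsVertical e) : hor e = 0 := by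
  rcases he with rfl | rfl
  · simp
  · simp [hor, e2]

theorem IsVertical.mink_self {e : V} (he : IsVertical e) : mink e e = 1 := by
  rcases he with rfl | rfl <;> simp [mink, e2]

theorem IsVertical.mink_sq {e : V} (he : IsVertical e) (x : V) : mink x e ^ 2 = x 2 ^ 2 := by
  rcases he with rfl | rfl <;> simp [mink, e2]

theorem IsVertical.decomp {e : V} (he : IsVertical e) (x : V) : hor x + mink x e • e = x := by
  rcases he with rfl | rfl
  · rw [mink_e2_right, hor_add_vert]
  · rw [mink_neg_right, neg_smul_neg, mink_e2_right, hor_add_vert]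

theorem IsVertical.mink_eq_zero {e : V} (he : IsVertical e) {x : V} (hx : x 2 = 0) :
    mink x e = 0 := by
  have := he.mink_sq x
  rw [hx] at this
  simpa using this

theorem IsVertical.mink_hor {e : V} (he : IsVertical e) (x : V) : mink (hor x) e = 0 :=
  he.mink_eq_zero (hor_two x)

theorem IsVertical.hor_add_smul {e : V} (he : IsVertical e) (x : V) (s : ℝ) :
    hor (x + s • e) = hor x := by rw [hor_add, hor_smul, he.hor_eq, smul_zero, add_zero]

theorem IsVertical.mink_add_smul {e : V} (he : IsVertical e) (x : V) (s : ℝ) :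
    mink (hor x + s • e) e = s := by
  rw [mink_add_left, he.mink_hor, mink_smul_left, he.mink_self]; ring

theorem IsVertical.eq_of_hor_eq {e : V} (he : IsVertical e) {x y : V} (h : hor x = hor y) :
    y = x + (mink y e - mink x e) • e := by
  conv_lhs => rw [← he.decomp y, ← h]
  conv_rhs => rw [← he.decomp x]
  rw [he.mink_add_smul, sub_smul]; abel

theorem IsVertical.mem_TL_iff {e : V} (he : IsVertical e) {q : V} (hq : q ∈ TL) (s : ℝ) :
    hor q + s • e ∈ TL ↔ s ^ 2 < -mink (hor q) (hor q) := by
  have h3 : (hor q + s • e) 3 = hor q 3 := by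
    rcases he with rfl | rfl <;> simp [e2]
  have hm : mink (hor q + s • e) (hor q + s • e) = mink (hor q) (hor q) + s ^ 2 := by
    rw [mink_add_left, mink_add_right, mink_add_right, mink_smul_left, mink_smul_left,
      mink_smul_right, mink_smul_right, he.mink_self, mink_comm e, he.mink_hor]
    ring
  change mink _ _ < 0 ∧ 0 < _ ↔ _
  rw [h3, hm]
  have := (hor_mem_TL hq).2
  constructor
  · rintro ⟨h, -⟩; linarith
  · intro h; exact ⟨by linarith, this⟩

section Between

variable {N : Set V} (hN : IsLocallyCut N)
include hN

/-- Off the boundary, membership in the cone is locally constant, hence constant along a connected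
segment. -/
theorem exists_mem_Phat_between {x e : V} {s₁ : ℝ} (hs₁ : 0 ≤ s₁) (hx : x ∈ Chat N)
    (hT : ∀ s ∈ Set.Icc 0 s₁, x + s • e ∈ TL) (h1 : x + s₁ • e ∉ Chat N) :
    ∃ s ∈ Set.Icc 0 s₁, x + s • e ∈ Phat N := by
  by_contra hne
  push Not at hne
  have hc : ∀ s, ContinuousAt (fun s : ℝ => x + s • e) s := fun s => by fun_prop
  have key := (isPreconnected_Icc (a := (0 : ℝ)) (b := s₁)).induction₂'
    (fun s s' => x + s • e ∈ Chat N → x + s' • e ∈ Chat N) (fun s hs => by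
      by_cases hC : x + s • e ∈ Chat N
      · have := (hc s).eventually (eventually_mem_Chat hN hC (hne s hs))
        filter_upwards [this.filter_mono nhdsWithin_le_nhds] with s' hs'
        exact ⟨fun _ => hs', fun _ => hC⟩
      · have : ∃ n ∈ N, 0 < mink n (x + s • e) := by
          by_contra hn; push Not at hn; exact hC ⟨hT s hs, hn⟩
        obtain ⟨n, hn, hpos⟩ := this
        have := (hc s).eventually (eventually_notMem_Chat hn hpos)
        filter_upwards [this.filter_mono nhdsWithin_le_nhds] with s' hs'
        exact ⟨fun h => absurd h hC, fun h => absurd h hs'⟩)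
    (fun a b c _ _ _ h1 h2 h => h2 (h1 h)) (Set.left_mem_Icc.2 hs₁) (Set.right_mem_Icc.2 hs₁)
  exact h1 (key (by simpa using hx))

end Between

namespace IsGraph

variable {N : Set V} {e : V} (g : IsGraph N e)
include g

theorem vert : IsVertical e := g.unit

/-- A normal active at `x` increases strictly along `e`. Combined with sums of cone elements, this
inequality is the source of the uniqueness of heights and of the concavity used at a vertex. -/
theorem not_above {x : V} (hx : x ∈ Phat N) {s : ℝ} (h : x + s • e ∈ Chat N) : s ≤ 0 := by
  by_contra hs
  push Not at hs
  obtain ⟨-, n, hn, h0⟩ := id hx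
  have := h.2 n hn
  rw [mink_add_right, h0, mink_smul_right, zero_add] at this
  exact absurd this (not_le.2 (mul_pos hs (g.up x hx n hn h0)))

theorem eq_of_hor_eq {x y : V} (hx : x ∈ Phat N) (hy : y ∈ Phat N) (h : hor x = hor y) :
    x = y := by
  have e1 := g.vert.eq_of_hor_eq h
  have e2 := g.vert.eq_of_hor_eq h.symm
  have h1 := g.not_above hx (e1 ▸ hy.1)
  have h2 := g.not_above hy (e2 ▸ hx.1)
  have : mink y e - mink x e = 0 := by linarith
  rw [this, zero_smul, add_zero] at e1
  exact e1.symm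

theorem hor_mem_Chat {x : V} (hx : x ∈ TL) : hor x ∈ Chat N :=
  ⟨hor_mem_TL hx, fun n hn => g.plane n hn _ (hor_mem_TL hx) (hor_two x)⟩

theorem height_nonneg {x : V} (hx : x ∈ Phat N) : 0 ≤ mink x e := by
  have h : x + (-mink x e) • e ∈ Chat N := by
    have := g.hor_mem_Chat hx.1.1
    rwa [g.vert.eq_of_hor_eq (x := x) (y := hor x) (by simp), g.vert.mink_hor, zero_sub] at this
  linarith [g.not_above hx h]

/-- The vertical segment from the plane to a point slightly above `x` starts in the cone and ends
outside it. Both facts, and the timelikeness of the segment, persist for nearby `q'`. -/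
theorem eventually_exists {x q : V} (hx : x ∈ Phat N) (h : hor x = hor q) :
    ∀ᶠ q' in 𝓝 q, ∃ x' ∈ Phat N, hor x' = hor q' := by
  have hq : hor q ∈ TL := h ▸ hor_mem_TL hx.1.1
  set a := mink x e with ha
  have ha0 : 0 ≤ a := g.height_nonneg hx
  have hxe : x = hor q + a • e := by rw [← h, g.vert.decomp]
  have hc1 : ContinuousAt (fun η : ℝ => x + η • e) 0 := by fun_prop
  obtain ⟨η, hη, hη0⟩ := (((hc1.eventually (isOpen_TL.mem_nhds (by simpa using hx.1.1))).filter_mono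
    nhdsWithin_le_nhds).and (self_mem_nhdsWithin : ∀ᶠ s : ℝ in 𝓝[>] 0, s ∈ Set.Ioi 0)).exists
  have hη0 : 0 < η := hη0
  have hnot : x + η • e ∉ Chat N := fun hC => absurd (g.not_above hx hC) (not_le.2 hη0)
  obtain ⟨n, hn, hpos⟩ : ∃ n ∈ N, 0 < mink n (x + η • e) := by
    by_contra hn; push Not at hn; exact hnot ⟨hη, hn⟩
  have hval : x + η • e = hor q + (a + η) • e := by rw [hxe, add_smul]; abel
  rw [hval] at hη hpos
  have hc2 : ContinuousAt (fun q' => hor q' + (a + η) • e) q := by fun_prop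
  have hc3 : ContinuousAt hor q := continuous_hor.continuousAt
  filter_upwards [hc2.eventually (isOpen_TL.mem_nhds hη),
    hc2.eventually (eventually_notMem_Chat hn hpos), hc3.eventually (isOpen_TL.mem_nhds hq)]
    with q' h1 h2 h3
  have h4 := g.vert.mem_TL_iff h3
  rw [hor_hor] at h4
  have h5 := (h4 _).1 h1
  obtain ⟨s, -, hs⟩ := exists_mem_Phat_between g.fin (x := hor q') (e := e) (s₁ := a + η)
    (by linarith) (by simpa using g.hor_mem_Chat h3)
    (fun s hs => (h4 s).2 (lt_of_le_of_lt (pow_le_pow_left₀ hs.1 hs.2 2) h5)) h2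
  exact ⟨_, hs, by rw [g.vert.hor_add_smul, hor_hor]⟩

/-- If the vertical line misses the boundary, its point at height `s` is interior, where `κ * m < s
^ 2 < m`. Over nearby `q'` a boundary point would have height at least `s`, against `bound`; the
room for `s` comes from `κ < 1`. -/
theorem eventually_not_exists {q : V} (hq : q ∈ TL) (h : ¬ ∃ x ∈ Phat N, hor x = hor q) :
    ∀ᶠ q' in 𝓝 q, ¬ ∃ x' ∈ Phat N, hor x' = hor q' := by
  obtain ⟨κ, hκ1, hκ⟩ := g.bound
  set m := -mink (hor q) (hor q) with hm
  have hm0 : 0 < m := by linarith [(hor_mem_TL hq).1]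
  obtain ⟨s, hs0, hs1, hs2⟩ : ∃ s : ℝ, 0 ≤ s ∧ κ * m < s ^ 2 ∧ s ^ 2 < m := by
    by_cases hk : κ < 0
    · exact ⟨0, le_rfl, by nlinarith, by simpa using hm0⟩
    · push Not at hk
      have hp : 0 ≤ (κ + 1) / 2 * m := by positivity
      refine ⟨√((κ + 1) / 2 * m), Real.sqrt_nonneg _, ?_, ?_⟩ <;> rw [Real.sq_sqrt hp] <;> nlinarith
  have hnP : ∀ s : ℝ, hor q + s • e ∉ Phat N := fun s hs =>
    h ⟨_, hs, by rw [g.vert.hor_add_smul, hor_hor]⟩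
  have hC : hor q + s • e ∈ Chat N := by
    by_contra hC
    obtain ⟨s', -, h'⟩ := exists_mem_Phat_between g.fin hs0 (g.hor_mem_Chat hq)
      (fun s' hs' => (g.vert.mem_TL_iff hq s').2
        (lt_of_le_of_lt (pow_le_pow_left₀ hs'.1 hs'.2 2) hs2)) hC
    exact hnP _ h'
  have hc2 : ContinuousAt (fun q' => hor q' + s • e) q := by fun_prop
  have hc3 : ContinuousAt (fun q' => κ * -mink (hor q') (hor q')) q := by
    have : Continuous fun q' => κ * -mink (hor q') (hor q') := by fun_prop
    exact this.continuousAt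
  filter_upwards [hc2.eventually (eventually_mem_Chat g.fin hC (hnP s)),
    hc3.eventually (gt_mem_nhds hs1)] with q' h1 h2
  rintro ⟨x, hx, hxq⟩
  have h3 := hκ x hx
  rw [hxq, ← g.vert.mink_sq] at h3
  have h4 : mink x e < s := lt_of_pow_lt_pow_left₀ 2 hs0 (by linarith)
  have : x + (s - mink x e) • e = hor q' + s • e := by
    rw [← hxq, sub_smul]
    conv_lhs => rw [← g.vert.decomp x]
    rw [g.vert.mink_add_smul]; abel
  linarith [g.not_above hx (this ▸ h1)]

/-- The set of `q` below or above the boundary is open and closed in the connected cone `TL`, and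
not empty. -/
theorem exists_lift {q : V} (hq : q ∈ TL) : ∃ x ∈ Phat N, hor x = hor q := by
  obtain ⟨x, hx⟩ := g.nonempty
  refine convex_TL.isPreconnected.induction₂'
    (fun q q' => (∃ x ∈ Phat N, hor x = hor q) → ∃ x ∈ Phat N, hor x = hor q')
    (fun p hp => ?_) (fun a b c _ _ _ h1 h2 h => h2 (h1 h)) hx.1.1 hq ⟨x, hx, rfl⟩
  by_cases h : ∃ x ∈ Phat N, hor x = hor p
  · obtain ⟨y, hy, hyp⟩ := id h
    filter_upwards [(g.eventually_exists hy hyp).filter_mono nhdsWithin_le_nhds] with p' hp'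
    exact ⟨fun _ => hp', fun _ => h⟩
  · filter_upwards [(g.eventually_not_exists hp h).filter_mono nhdsWithin_le_nhds] with p' hp'
    exact ⟨fun h' => absurd h' h, fun h' => absurd h' hp'⟩

omit g in
/-- The point of the boundary above or below a given point. -/
noncomputable def lift (N : Set V) (q : V) : V :=
  open Classical in if h : ∃ x ∈ Phat N, hor x = hor q then h.choose else 0

theorem lift_mem {q : V} (hq : q ∈ TL) : lift N q ∈ Phat N := by
  have h := g.exists_lift hq
  rw [lift, dif_pos h]; exact h.choose_spec.1

theorem hor_lift {q : V} (hq : q ∈ TL) : hor (lift N q) = hor q := by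
  have h := g.exists_lift hq
  rw [lift, dif_pos h]; exact h.choose_spec.2

theorem lift_eq {q x : V} (hx : x ∈ Phat N) (h : hor x = hor q) : lift N q = x := by
  have h' : ∃ x ∈ Phat N, hor x = hor q := ⟨x, hx, h⟩
  rw [lift, dif_pos h']
  exact g.eq_of_hor_eq h'.choose_spec.1 hx (h'.choose_spec.2.trans h.symm)

theorem lift_eq_hor_add {q : V} (hq : q ∈ TL) :
    lift N q = hor q + mink (lift N q) e • e := by
  rw [← g.hor_lift hq, g.vert.decomp]

/-- Points of the cone lie below its boundary. -/
theorem height_le {x : V} (hx : x ∈ Phat N) {y : V} (hy : y ∈ Chat N) (h : hor x = hor y) :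
    mink y e ≤ mink x e := by
  have := g.vert.eq_of_hor_eq h
  linarith [g.not_above hx (this ▸ hy)]

/-- The height is trapped between two barriers: a point `η` below, interior to the cone, and a point
`η` above, where an active functional is positive. Both conditions are open in `q`. -/
theorem continuousAt_lift {q : V} (hq : q ∈ TL) : ContinuousAt (lift N) q := by
  have hP := g.lift_mem hq
  set a := mink (lift N q) e with ha
  have hle := g.lift_eq_hor_add hq
  rw [← ha] at hle
  obtain ⟨N₁, hsub, hfin, hact, hev⟩ := g.fin _ hP.1
  have hheight : ContinuousAt (fun q' => mink (lift N q') e) q := by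
    refine Metric.continuousAt_iff'.2 fun ε hε => ?_
    have hT : ContinuousAt (fun η : ℝ => hor q + (a - η) • e) 0 := by fun_prop
    have h0 : hor q + (a - 0) • e = lift N q := by rw [sub_zero, ← hle]
    have hev1 := hT.eventually (p := fun y => (∀ n ∈ N₁, mink n y ≤ 0) → y ∈ Chat N)
      (by simpa only [h0] using hev)
    obtain ⟨η, hη, hη0⟩ := ((hev1.filter_mono nhdsWithin_le_nhds).and
      (Ioo_mem_nhdsGT hε : ∀ᶠ s : ℝ in 𝓝[>] 0, s ∈ Set.Ioo 0 ε)).exists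
    have hneg : ∀ n ∈ N₁, mink n (hor q + (a - η) • e) < 0 := fun n hn => by
      have h1 := hact n hn
      have h2 := g.up _ hP n (hsub hn) h1
      rw [hle] at h1
      rw [mink_add_right, mink_smul_right] at h1 ⊢
      nlinarith [hη0.1]
    have hlow : hor q + (a - η) • e ∈ Chat N := hη fun n hn => (hneg n hn).le
    have hnP : hor q + (a - η) • e ∉ Phat N := fun hP' => by
      have : hor q + (a - η) • e + η • e = lift N q := by
        rw [hle, sub_smul]; abel
      linarith [g.not_above hP' (this ▸ hP.1), hη0.1]
    obtain ⟨-, n, hn, hn0⟩ := id hP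
    have hup := g.up _ hP n hn hn0
    have hpos : 0 < mink n (hor q + (a + η) • e) := by
      rw [hle] at hn0
      rw [mink_add_right, mink_smul_right] at hn0 ⊢
      nlinarith [hη0.1]
    have hc1 : ContinuousAt (fun q' => hor q' + (a - η) • e) q := by fun_prop
    have hc2 : ContinuousAt (fun q' => mink n (hor q' + (a + η) • e)) q := by
      have : Continuous (fun q' => mink n (hor q' + (a + η) • e)) := by fun_prop
      exact this.continuousAt
    filter_upwards [hc1.eventually (eventually_mem_Chat g.fin hlow hnP),
      hc2.eventually (lt_mem_nhds hpos), isOpen_TL.mem_nhds hq] with q' h1 h2 h3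
    have hle' := g.lift_eq_hor_add h3
    have hP' := g.lift_mem h3
    have hb1 : a - η ≤ mink (lift N q') e := by
      have := g.height_le hP' h1 (by rw [g.vert.hor_add_smul, hor_hor, g.hor_lift h3])
      rwa [g.vert.mink_add_smul] at this
    have hb2 : mink (lift N q') e ≤ a + η := by
      have := hP'.1.2 n hn
      rw [hle', mink_add_right, mink_smul_right] at this
      rw [mink_add_right, mink_smul_right] at h2
      by_contra hlt
      push Not at hlt
      nlinarith
    rw [Real.dist_eq]
    exact lt_of_le_of_lt (abs_le.2 ⟨by linarith, by linarith⟩) hη0.2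
  have : (fun q' => hor q' + mink (lift N q') e • e) =ᶠ[𝓝 q] lift N := by
    filter_upwards [isOpen_TL.mem_nhds hq] with q' hq'
    exact (g.lift_eq_hor_add hq').symm
  refine ContinuousAt.congr ?_ this
  exact continuous_hor.continuousAt.add (hheight.smul continuousAt_const)

end IsGraph

/-! ### The boundary of a triangulated convex Fuchsian polyhedron is a graph -/

theorem exists_pos_add_smul_mem_TL {x : V} (hx : x ∈ TL) (v : V) :
    ∃ s : ℝ, 0 < s ∧ x + s • v ∈ TL ∧ x - s • v ∈ TL := by
  have h1 : ContinuousAt (fun s : ℝ => x + s • v) 0 := by fun_prop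
  have h2 : ContinuousAt (fun s : ℝ => x - s • v) 0 := by fun_prop
  have e1 := h1.eventually (isOpen_TL.mem_nhds (by simpa using hx))
  have e2 := h2.eventually (isOpen_TL.mem_nhds (by simpa using hx))
  obtain ⟨s, ⟨hs1, hs2⟩, hs⟩ := (((e1.and e2).filter_mono nhdsWithin_le_nhds).and
    (self_mem_nhdsWithin : ∀ᶠ s : ℝ in 𝓝[>] 0, s ∈ Set.Ioi 0)).exists
  exact ⟨s, hs, hs1, hs2⟩

theorem timeAxis_mem_TL : (Pi.single 3 1 : V) ∈ TL := by constructor <;> simp [mink]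

theorem mem_span_PH2 {v : V} (hv : v 2 = 0) : v ∈ Submodule.span ℝ PH2 := by
  have key : ∀ x ∈ TL, x 2 = 0 → x ∈ Submodule.span ℝ PH2 := fun x hx hx2 => by
    rw [← len_smul_nrm hx]
    exact Submodule.smul_mem _ _ (Submodule.subset_span ⟨nrm_mem_H3 hx, by simp [nrm, hx2]⟩)
  obtain ⟨s, hs, h1, -⟩ := exists_pos_add_smul_mem_TL timeAxis_mem_TL v
  have : v = s⁻¹ • (((Pi.single 3 1 : V) + s • v) - Pi.single 3 1) := by
    rw [add_sub_cancel_left, smul_smul, inv_mul_cancel₀ hs.ne', one_smul]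
  rw [this]
  exact Submodule.smul_mem _ _ (Submodule.sub_mem _ (key _ h1 (by simp [hv]))
    (key _ timeAxis_mem_TL (by simp)))

theorem finrank_span_PH2 : Module.finrank ℝ (Submodule.span ℝ PH2) = 3 := by
  have : Submodule.span ℝ PH2 = LinearMap.ker (minkL e2) := by
    apply le_antisymm
    · rw [Submodule.span_le]
      intro x hx
      simpa [mink_e2_left] using hx.2
    · intro x hx
      refine mem_span_PH2 ?_
      simpa [mink_e2_left] using hx
  rw [this]
  have h := Module.Dual.finrank_ker_add_one_of_ne_zero (f := minkL e2) (fun h => by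
    have := LinearMap.congr_fun h e2
    simp [mink_e2_e2] at this)
  have h4 : Module.finrank ℝ V = 4 := by simp
  omega

/-- A linear functional that is nonpositive on the horizontal timelike vectors and vanishes at one
of them is vertical. -/
theorem mink_eq_of_nonpos {n x : V} (hn : ∀ u ∈ TL, u 2 = 0 → mink n u ≤ 0) (hx : x ∈ TL)
    (hx2 : x 2 = 0) (h0 : mink n x = 0) (y : V) : mink n y = n 2 * y 2 := by
  obtain ⟨s, hs, h1, h2⟩ := exists_pos_add_smul_mem_TL hx (hor y)
  have h1 := hn _ h1 (by simp [hx2])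
  have h2 := hn _ h2 (by simp [hx2])
  rw [mink_add_right, h0, mink_smul_right, zero_add] at h1
  rw [mink_sub_right, h0, mink_smul_right, zero_sub] at h2
  have h3 : s * mink n (hor y) = 0 := by linarith
  have h4 := (mul_eq_zero.1 h3).resolve_left hs.ne'
  conv_lhs => rw [← hor_add_vert y]
  rw [mink_add_right, h4, mink_smul_right, mink_e2_right]
  ring

/-- If `n 2` were zero, the spacelike `n` would take a positive value at some horizontal timelike
vector: its plane would cut the horizontal one. -/
theorem two_ne_zero_of_nonpos {n : V} (hpos : 0 < mink n n)
    (hn : ∀ u ∈ TL, u 2 = 0 → mink n u ≤ 0) : n 2 ≠ 0 := by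
  intro h2
  set r := √(n 0 ^ 2 + n 1 ^ 2) with hr
  have hr2 : r ^ 2 = n 0 ^ 2 + n 1 ^ 2 := Real.sq_sqrt (by positivity)
  have hr0 : 0 ≤ r := Real.sqrt_nonneg _
  simp only [mink, h2] at hpos
  have h3 : |n 3| < r := abs_lt_of_sq_lt_sq (by nlinarith) hr0
  have hr1 : 0 < r := lt_of_le_of_lt (abs_nonneg _) h3
  have hd : 0 < r + |n 3| := by positivity
  -- This `w` satisfies both `r < w`, so that the test vector is timelike, and `|n 3| * w < r ^ 2`,
  -- so that the functional is positive there.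
  set w := 2 * r ^ 2 / (r + |n 3|) with hw
  have hwr : w * (r + |n 3|) = 2 * r ^ 2 := by rw [hw]; field_simp
  have hw1 : r < w := by
    rw [hw, lt_div_iff₀ hd]; nlinarith
  have hw2 : |n 3| * w < r ^ 2 := by nlinarith
  have := hn ![n 0, n 1, 0, w] ⟨by simp only [mink, Matrix.cons_val]; nlinarith,
    by simp only [Matrix.cons_val]; linarith⟩ (by simp)
  simp only [mink, Matrix.cons_val] at this
  nlinarith [le_abs_self (n 3)]

theorem mem_convexHull_pair {x y : V} {a b : ℝ} (ha : 0 ≤ a) (hb : 0 ≤ b) (hab : 0 < a + b) :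
    (a + b)⁻¹ • (a • x + b • y) ∈ convexHull ℝ {x, y} := by
  rw [convexHull_pair]
  refine ⟨a / (a + b), b / (a + b), by positivity, by positivity, by field_simp, ?_⟩
  rw [smul_add, smul_smul, smul_smul, div_eq_inv_mul, div_eq_inv_mul]

/-- This is the homogeneous form of the definition of a vertex: its ray is extreme in the cone. -/
theorem Presents.vertex_eq {N C : Set V} (h : Presents N C) {v : V} (hv : IsVertex C v) {x y : V}
    (hx : x ∈ Chat N) (hy : y ∈ Chat N) {c : ℝ} (hc : 0 < c) (hxy : c • v = x + y) :
    nrm x = v ∨ nrm y = v := by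
  have hlx := len_pos hx.1
  have hly := len_pos hy.1
  have := hv.2 _ (h.nrm_mem hx) _ (h.nrm_mem hy) ⟨(h.mem_iff.1 hv.1).1,
    (len x + len y)⁻¹ * c, by positivity, ?_⟩
  · exact this.imp Eq.symm Eq.symm
  · rw [mul_smul, hxy]
    have h1 := mem_convexHull_pair (x := nrm x) (y := nrm y) hlx.le hly.le (by positivity)
    rwa [len_smul_nrm hx.1, len_smul_nrm hy.1] at h1

section

variable {N C : Set V} {F : Subgroup G4} (h : IsConvexFuchsianPolyhedron C F) (hP : Presents N C)
include h hP

omit hP in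
theorem IsConvexFuchsianPolyhedron.act_mem_boundary {f : G4} (hf : f ∈ F) {x : V}
    (hx : x ∈ boundary C) : act f x ∈ boundary C :=
  h.invariant f hf ▸ ⟨x, hx, rfl⟩

theorem IsConvexFuchsianPolyhedron.mink_nonpos {n : V} (hn : ∀ x ∈ C, mink n x ≤ 0) {u : V}
    (hu : u ∈ TL) (hu2 : u 2 = 0) : mink n u ≤ 0 := by
  obtain ⟨y, hy⟩ := h.connected.nonempty
  refine h.group.mink_nonpos (y := y) (H3_subset_TL (hP.mem_boundary_iff.1 hy).1) (fun f hf => ?_)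
    hu hu2
  exact hn _ (h.act_mem_boundary hf hy).1

theorem IsConvexFuchsianPolyhedron.mink_nonpos_of_mem {n : V} (hn : n ∈ N) :
    ∀ u ∈ TL, u 2 = 0 → mink n u ≤ 0 := fun _ hu hu2 =>
  h.mink_nonpos hP (fun _ hx => (hP.mem_iff.1 hx).2.2 n hn) hu hu2

/-- Opposite signs put `x` in the horizontal plane and make both functionals vertical, so `C`
collapses to `PH2`. That is a single face without vertices, whereas a triangulation must supply one.
-/
theorem IsConvexFuchsianPolyhedron.not_opposite {T : Set (Set V)} (hT : IsTriangulation C T)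
    {x n n' : V} (hx : x ∈ TL) (hn : n ∈ N) (hn' : n' ∈ N) (h0 : mink n x = 0)
    (h0' : mink n' x = 0) (hp : 0 < n 2) (hp' : n' 2 < 0) : False := by
  have hexp : ∀ m : V, mink m x = mink m (hor x) + x 2 * m 2 := fun m => by
    conv_lhs => rw [← hor_add_vert x]
    rw [mink_add_right, mink_smul_right, mink_e2_right]
  have hh := h.mink_nonpos_of_mem hP hn _ (hor_mem_TL hx) (hor_two x)
  have hh' := h.mink_nonpos_of_mem hP hn' _ (hor_mem_TL hx) (hor_two x)
  have e1 := hexp n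
  have e2' := hexp n'
  have hx2 : x 2 = 0 := by
    apply le_antisymm
    · by_contra hc; push Not at hc; nlinarith
    · by_contra hc; push Not at hc; nlinarith
  have k := mink_eq_of_nonpos (h.mink_nonpos_of_mem hP hn) hx hx2 h0
  have k' := mink_eq_of_nonpos (h.mink_nonpos_of_mem hP hn') hx hx2 h0'
  have hC2 : ∀ y ∈ C, y 2 = 0 := fun y hy => by
    have hyC := (hP.mem_iff.1 hy).2
    have a1 := hyC.2 n hn
    have a2 := hyC.2 n' hn'
    rw [k] at a1
    rw [k'] at a2
    apply le_antisymm
    · by_contra hc; push Not at hc; nlinarith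
    · by_contra hc; push Not at hc; nlinarith
  have hCh : ∀ y ∈ TL, y 2 = 0 → y ∈ Chat N := fun y hy hy2 =>
    ⟨hy, fun m hm => h.mink_nonpos_of_mem hP hm y hy hy2⟩
  have hCeq : C = PH2 := by
    ext y
    exact ⟨fun hy => ⟨(hP.mem_iff.1 hy).1, hC2 y hy⟩,
      fun hy => hP.mem_iff.2 ⟨hy.1, hCh y (H3_subset_TL hy.1) hy.2⟩⟩
  have hface : IsFace C C := by
    refine ⟨e2, by rw [mink_e2_e2]; norm_num, fun y hy => by rw [mink_e2_left, hC2 y hy], ?_, ?_⟩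
    · ext y; exact ⟨fun hy => ⟨hy, by rw [mink_e2_left, hC2 y hy]⟩, fun hy => hy.1⟩
    · rw [hCeq]; exact finrank_span_PH2
  obtain ⟨t, ht, -, -⟩ := hT.cover C hface _ (hP.nrm_mem (hCh x hx hx2))
  obtain ⟨a, ha⟩ := Set.nonempty_of_ncard_ne_zero (s := t) (by rw [hT.three t ht]; norm_num)
  have hav := hT.vertices t ht a ha
  have haH := (hP.mem_iff.1 hav.1).1
  obtain ⟨s, hs, h1, h2⟩ := exists_pos_add_smul_mem_TL (H3_subset_TL haH) (Pi.single 0 1)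
  have key : ∀ s : ℝ, s ≠ 0 → a + s • (Pi.single 0 1 : V) ∈ TL →
      nrm (a + s • (Pi.single 0 1 : V)) ≠ a := fun s hs hT heq => by
    have h3 := len_smul_nrm hT
    rw [heq] at h3
    set l := len (a + s • (Pi.single 0 1 : V))
    have h4 : (Pi.single 0 1 : V) = (s⁻¹ * (l - 1)) • a := by
      rw [mul_smul, sub_smul, h3, one_smul, add_sub_cancel_left, smul_smul, inv_mul_cancel₀ hs,
        one_smul]
    have h5 : mink (Pi.single 0 1 : V) (Pi.single 0 1) = 1 := by simp [mink]
    rw [h4, mink_smul_left, mink_smul_right, haH.1] at h5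
    nlinarith [sq_nonneg (s⁻¹ * (l - 1))]
  have ha2 := hC2 a hav.1
  rcases hP.vertex_eq hav (hCh _ h1 (by simp [ha2])) (hCh _ h2 (by simp [ha2])) two_pos
    (by rw [two_smul]; abel) with h3 | h3
  · exact key s hs.ne' h1 h3
  · rw [sub_eq_add_neg, ← neg_smul] at h2 h3
    exact key (-s) (neg_ne_zero.2 hs.ne') h2 h3

omit hP in
theorem IsConvexFuchsianPolyhedron.exists_bound :
    ∃ M : ℝ, ∀ x ∈ boundary C, |x 2| ≤ M := by
  obtain ⟨B, -, hB, hcov⟩ := h.cocompact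
  obtain ⟨M, hM⟩ := (hB.image (f := fun b : V => |b 2|) (by fun_prop)).bddAbove
  refine ⟨M, fun x hx => ?_⟩
  obtain ⟨f, hf, hfB⟩ := hcov x hx
  rw [← h.group.abs_act_two hf]
  exact hM ⟨_, hfB, rfl⟩

theorem IsConvexFuchsianPolyhedron.exists_isGraph {T : Set (Set V)} (hT : IsTriangulation C T) :
    ∃ e, IsGraph N e := by
  have hne : ∀ n ∈ N, n 2 ≠ 0 := fun n hn =>
    two_ne_zero_of_nonpos (hP.pos n hn) (h.mink_nonpos_of_mem hP hn)
  have hbound : ∃ κ : ℝ, κ < 1 ∧ ∀ x ∈ Phat N, x 2 ^ 2 ≤ κ * -mink (hor x) (hor x) := by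
    obtain ⟨M, hM⟩ := h.exists_bound
    -- On `H3`, `x 2` is the hyperbolic sine of the signed distance; a bound `M` on it bounds the
    -- squared hyperbolic tangent by `M ^ 2 / (1 + M ^ 2)`.
    refine ⟨M ^ 2 / (1 + M ^ 2), by rw [div_lt_one (by positivity)]; linarith, fun x hx => ?_⟩
    have h1 := hM _ (hP.nrm_mem_boundary hx)
    have h2 := pow_le_pow_left₀ (abs_nonneg _) h1 2
    have hl := len_pos hx.1.1
    rw [sq_abs, nrm, Pi.smul_apply, smul_eq_mul, mul_pow, inv_pow, len_sq hx.1.1] at h2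
    have hx1 := hx.1.1.1
    have h3 : x 2 ^ 2 ≤ M ^ 2 * (-mink x x) := by
      rw [inv_mul_le_iff₀ (by linarith)] at h2
      linarith
    rw [mink_hor_hor, div_mul_eq_mul_div, le_div_iff₀ (by positivity)]
    nlinarith
  obtain ⟨x₀, hx₀⟩ := h.connected.nonempty
  have hx₀P := (hP.mem_boundary_iff.1 hx₀).2
  -- Normals active near `x` are active at `x`, and those active at one point share a sign;
  -- connectedness spreads the sign over the boundary. It decides between `e2` and `-e2`.
  have hall : ∀ {x y : V}, x ∈ boundary C → y ∈ boundary C → ((∃ n ∈ N, mink n x = 0 ∧ 0 < n 2) →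
      ∃ n ∈ N, mink n y = 0 ∧ 0 < n 2) := by
    intro x y hx hy
    refine h.connected.isPreconnected.induction₂' (fun x y => (∃ n ∈ N, mink n x = 0 ∧ 0 < n 2) →
      ∃ n ∈ N, mink n y = 0 ∧ 0 < n 2) (fun x hx => ?_)
      (fun _ _ _ _ _ _ h1 h2 h => h2 (h1 h)) hx hy
    have hxP := (hP.mem_boundary_iff.1 hx).2
    obtain ⟨N₁, hsub, -, hact, -, hev⟩ := hP.fin.exists_active hP.pos hxP.1
    filter_upwards [hev.filter_mono nhdsWithin_le_nhds, self_mem_nhdsWithin] with y hy hyB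
    have hyP := (hP.mem_boundary_iff.1 hyB).2
    obtain ⟨m, hm, hm0⟩ := hy hyP
    refine ⟨fun ⟨n, hn, hn0, hp⟩ => ⟨m, hsub hm, hm0, ?_⟩, fun ⟨n, hn, hn0, hp⟩ =>
      ⟨m, hsub hm, hact m hm, ?_⟩⟩
    · exact lt_of_le_of_ne (le_of_not_gt fun hlt =>
        h.not_opposite hP hT hxP.1.1 hn (hsub hm) hn0 (hact m hm) hp hlt) (hne m (hsub hm)).symm
    · exact lt_of_le_of_ne (le_of_not_gt fun hlt =>
        h.not_opposite hP hT hyP.1.1 hn (hsub hm) hn0 hm0 hp hlt) (hne m (hsub hm)).symm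
  have hnrm : ∀ {x n : V}, mink n x = 0 → mink n (nrm x) = 0 := fun h0 => by
    rw [nrm, mink_smul_right, h0, mul_zero]
  by_cases hp : ∃ n ∈ N, mink n x₀ = 0 ∧ 0 < n 2
  · refine ⟨e2, Or.inl rfl, hP.pos, hP.fin, fun x hx n hn h0 => ?_,
      fun n hn => h.mink_nonpos_of_mem hP hn, hbound, ⟨_, hx₀P⟩⟩
    obtain ⟨m, hm, hm0, hmp⟩ := hall hx₀ (hP.nrm_mem_boundary hx) hp
    rw [mink_e2_right]
    exact lt_of_le_of_ne (le_of_not_gt fun hlt => h.not_opposite hP hT (nrm_mem_Phat hx).1.1 hm hn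
      hm0 (hnrm h0) hmp hlt) (hne n hn).symm
  · refine ⟨-e2, Or.inr rfl, hP.pos, hP.fin, fun x hx n hn h0 => ?_,
      fun n hn => h.mink_nonpos_of_mem hP hn, hbound, ⟨_, hx₀P⟩⟩
    rw [mink_neg_right, mink_e2_right, neg_pos]
    refine lt_of_le_of_ne (le_of_not_gt fun hlt => hp ?_) (hne n hn)
    exact hall (hP.nrm_mem_boundary hx) hx₀ ⟨n, hn, hnrm h0, hlt⟩

end

/-! ### Cones over triangles -/

/-- The cone over the hyperbolic convex hull of a set. -/
def tcone (t : Set V) : Set V := {x | x ∈ TL ∧ ∃ r : ℝ, 0 < r ∧ r • x ∈ convexHull ℝ t}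

theorem tcone_smul {t : Set V} {x : V} (hx : x ∈ tcone t) {c : ℝ} (hc : 0 < c) :
    c • x ∈ tcone t := by
  obtain ⟨hT, r, hr, h⟩ := hx
  refine ⟨TL_smul hT hc, r * c⁻¹, by positivity, ?_⟩
  rwa [smul_smul, mul_assoc, inv_mul_cancel₀ hc.ne', mul_one]

theorem tcone_add {t : Set V} {x y : V} (hx : x ∈ tcone t) (hy : y ∈ tcone t) :
    x + y ∈ tcone t := by
  obtain ⟨hx, r, hr, h1⟩ := hx
  obtain ⟨hy, s, hs, h2⟩ := hy
  refine ⟨TL_add hx hy, (r⁻¹ + s⁻¹)⁻¹, by positivity, ?_⟩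
  have := (convex_convexHull ℝ t) h1 h2 (a := (r⁻¹ + s⁻¹)⁻¹ * r⁻¹) (b := (r⁻¹ + s⁻¹)⁻¹ * s⁻¹)
    (by positivity) (by positivity) (by rw [← mul_add, inv_mul_cancel₀ (by positivity)])
  rwa [smul_smul, smul_smul, mul_assoc, mul_assoc, inv_mul_cancel₀ hr.ne', inv_mul_cancel₀ hs.ne',
    mul_one, ← smul_add] at this

theorem nrm_mem_hconv_iff {t : Set V} {x : V} (hx : x ∈ TL) : nrm x ∈ hconv t ↔ x ∈ tcone t := by
  have hl := len_pos hx
  constructor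
  · rintro ⟨-, r, hr, h⟩
    exact ⟨hx, r * (len x)⁻¹, by positivity, by rwa [mul_smul]⟩
  · rintro ⟨-, r, hr, h⟩
    refine ⟨nrm_mem_H3 hx, r * len x, by positivity, ?_⟩
    rwa [mul_smul, len_smul_nrm hx]

theorem subset_tcone {t : Set V} (ht : t ⊆ TL) : t ⊆ tcone t := fun x hx =>
  ⟨ht hx, 1, one_pos, by rw [one_smul]; exact subset_convexHull ℝ t hx⟩

theorem mink_eq_zero_of_mem_tcone {t : Set V} {n : V} (h : ∀ x ∈ t, mink n x = 0) {x : V}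
    (hx : x ∈ tcone t) : mink n x = 0 := by
  obtain ⟨-, r, hr, h1⟩ := hx
  have : convexHull ℝ t ⊆ (LinearMap.ker (minkL n) : Set V) :=
    convexHull_min (fun y hy => by simpa using h y hy) (Submodule.convex _)
  have := this h1
  simp only [SetLike.mem_coe, LinearMap.mem_ker, minkL_apply, mink_smul_right] at this
  exact (mul_eq_zero.1 this).resolve_left hr.ne'

/-- A linear functional that is nonpositive at the vertices and vanishes somewhere on the cone
vanishes at a vertex. -/
theorem exists_eq_zero_of_mem_tcone {t : Set V} (φ : V →ₗ[ℝ] ℝ) (h : ∀ x ∈ t, φ x ≤ 0) {x : V}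
    (hx : x ∈ tcone t) (h0 : φ x = 0) : ∃ a ∈ t, φ a = 0 := by
  by_contra hne
  push Not at hne
  obtain ⟨-, r, hr, h1⟩ := hx
  have : convexHull ℝ t ⊆ {y | φ y < 0} :=
    convexHull_min (fun y hy => lt_of_le_of_ne (h y hy) (hne y hy))
      (convex_halfSpace_lt φ.isLinear 0)
  have := this h1
  simp [h0] at this

/-- Within `TL` the cone is the preimage under `nrm` of a compact set. -/
theorem eventually_notMem_tcone {t : Set V} (ht : t ⊆ TL) (hfin : t.Finite) {x : V} (hx : x ∈ TL)
    (h : x ∉ tcone t) : ∀ᶠ y in 𝓝 x, y ∉ tcone t := by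
  have hK : convexHull ℝ t ⊆ TL := convexHull_min ht convex_TL
  have hc : IsClosed (nrm '' convexHull ℝ t) := by
    have hcomp : IsCompact (convexHull ℝ t) := hfin.isCompact_convexHull ℝ
    refine (hcomp.image_of_continuousOn fun y hy => ?_).isClosed
    exact (continuousAt_nrm (hK hy)).continuousWithinAt
  have hx' : nrm x ∉ nrm '' convexHull ℝ t := by
    rintro ⟨k, hk, hkx⟩
    refine h ⟨hx, len k * (len x)⁻¹, mul_pos (len_pos (hK hk)) (inv_pos.2 (len_pos hx)), ?_⟩
    rw [mul_smul]
    change len k • nrm x ∈ _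
    rwa [← hkx, len_smul_nrm (hK hk)]
  filter_upwards [(continuousAt_nrm hx).eventually (hc.isOpen_compl.mem_nhds hx')] with y hy hyt
  obtain ⟨-, r, hr, h1⟩ := hyt
  exact hy ⟨_, h1, nrm_smul hr y⟩

/-! ### Triangulated graphs -/

/-- A graph over the horizontal plane that is triangulated without new vertices. -/
structure IsTriangulatedGraph (N : Set V) (e : V) (T : Set (Set V)) : Prop where
  graph : IsGraph N e
  sub_H3 : ∀ t ∈ T, t ⊆ H3
  finite : ∀ t ∈ T, t.Finite
  sub : ∀ t ∈ T, tcone t ⊆ Phat N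
  normal : ∀ t ∈ T, ∃ n, mink n e ≠ 0 ∧ ∀ x ∈ t, mink n x = 0
  span : ∀ t ∈ T, Submodule.span ℝ (insert e t) = ⊤
  vertex : ∀ t ∈ T, ∀ a ∈ t, ∀ x ∈ Chat N, ∀ y ∈ Chat N, ∀ c : ℝ, 0 < c → c • a = x + y →
    nrm x = a ∨ nrm y = a
  star : ∀ x ∈ Phat N, ∃ T₀ ⊆ T, T₀.Finite ∧ (∀ t ∈ T₀, x ∈ tcone t) ∧
    ∀ᶠ y in 𝓝 x, y ∈ Phat N → ∃ t ∈ T₀, y ∈ tcone t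

theorem finrank_ker_minkL {n : V} (hn : 0 < mink n n) :
    Module.finrank ℝ (LinearMap.ker (minkL n)) = 3 := by
  have h := Module.Dual.finrank_ker_add_one_of_ne_zero (f := minkL n) (fun h => by
    have := LinearMap.congr_fun h n
    simp only [minkL_apply, LinearMap.zero_apply] at this
    linarith)
  have h4 : Module.finrank ℝ V = 4 := by simp
  omega

theorem eventually_notMem_submodule (W : Submodule ℝ V) {a : V} (ha : a ∉ W) (y : V) :
    ∀ᶠ η : ℝ in 𝓝[>] 0, y + η • a ∉ W := by
  by_cases hy : y ∈ W
  · filter_upwards [self_mem_nhdsWithin] with η hη h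
    have h1 := (Submodule.add_mem_iff_right W hy).1 h
    exact ha ((Submodule.smul_mem_iff W (ne_of_gt hη)).1 h1)
  · have hc : ContinuousAt (fun η : ℝ => y + η • a) 0 := by fun_prop
    have := hc.eventually (W.closed_of_finiteDimensional.isOpen_compl.mem_nhds
      (by simpa using hy))
    exact this.filter_mono nhdsWithin_le_nhds

theorem exists_notMem_of_finrank_lt {ι : Type*} (s : Set ι) (hs : s.Finite)
    (W : ι → Submodule ℝ V) (hW : ∀ i ∈ s, Module.finrank ℝ (W i) < 4) : ∃ a, ∀ i ∈ s, a ∉ W i := by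
  classical
  have h := Subspace.biUnion_ne_univ_of_top_notMem (k := ℝ) (E := V) (s := hs.toFinset.image W) (by
    intro h
    obtain ⟨i, hi, hWi⟩ := Finset.mem_image.1 h
    have := hW i (by simpa using hi)
    rw [hWi, finrank_top] at this
    simp at this)
  obtain ⟨a, ha⟩ := (Set.ne_univ_iff_exists_notMem _).1 h
  refine ⟨a, fun i hi hia => ha ?_⟩
  simp only [Finset.mem_image, Set.Finite.mem_toFinset, Set.mem_iUnion]
  exact ⟨W i, ⟨i, hi, rfl⟩, hia⟩

/-- The part of the cone on a supporting plane. -/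
def facet (N : Set V) (n : V) : Set V := {x | x ∈ Chat N ∧ mink n x = 0}

/-- Near each of its points the boundary of the cone is covered by the facets of full dimension. -/
theorem IsGraph.eventually_mem_facet {N : Set V} {e : V} (g : IsGraph N e) {x : V}
    (hx : x ∈ Phat N) : ∃ N₁ ⊆ N, N₁.Finite ∧
      (∀ n ∈ N₁, Module.finrank ℝ (Submodule.span ℝ (facet N n)) = 3) ∧
      ∀ᶠ y in 𝓝 x, y ∈ Phat N → ∃ n ∈ N₁, mink n y = 0 := by
  obtain ⟨N₁, hsub, hfin, -, -, hev⟩ := g.fin.exists_active g.pos hx.1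
  refine ⟨{n ∈ N₁ | Module.finrank ℝ (Submodule.span ℝ (facet N n)) = 3},
    fun n hn => hsub hn.1, hfin.subset fun n hn => hn.1, fun n hn => hn.2, ?_⟩
  filter_upwards [eventually_eventually_nhds.2 hev] with y hy hyP
  by_contra hne
  push Not at hne
  set bad := {n ∈ N₁ | Module.finrank ℝ (Submodule.span ℝ (facet N n)) ≠ 3} with hbad
  have hbadfin : bad.Finite := hfin.subset fun n hn => hn.1
  -- Lower-dimensional facets project to proper subspaces. Moving `y` in a direction `a` outside all
  -- of them and lifting gives a boundary point on none of these facets, nor on the full ones, which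
  -- `y` avoids.
  set W : V → Submodule ℝ V := fun n => Submodule.span ℝ (facet N n) ⊔ Submodule.span ℝ {e}
  obtain ⟨a, ha⟩ := exists_notMem_of_finrank_lt bad hbadfin W (fun n hn => by
    have h1 : Submodule.span ℝ (facet N n) ≤ LinearMap.ker (minkL n) :=
      Submodule.span_le.2 fun z hz => by simpa using hz.2
    have h2 := Submodule.finrank_mono h1
    rw [finrank_ker_minkL (g.pos n (hsub hn.1))] at h2
    have h3 := hn.2
    have h4 := Submodule.finrank_add_le_finrank_add_finrank (Submodule.span ℝ (facet N n))
      (Submodule.span ℝ {e})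
    have h5 := finrank_span_le_card (R := ℝ) ({e} : Set V)
    simp only [Set.toFinset_singleton, Finset.card_singleton] at h5
    refine lt_of_le_of_lt h4 ?_
    omega)
  have hyT := hyP.1.1
  have hc : ContinuousAt (fun η : ℝ => y + η • a) 0 := by fun_prop
  have hlift : ContinuousAt (fun η : ℝ => IsGraph.lift N (y + η • a)) 0 := by
    refine ContinuousAt.comp (g := IsGraph.lift N) ?_ hc
    exact g.continuousAt_lift (by simpa using hyT)
  have hl0 : IsGraph.lift N (y + (0 : ℝ) • a) = y := by simpa using g.lift_eq hyP rfl
  have e1 := hc.eventually (isOpen_TL.mem_nhds (by simpa using hyT))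
  have e2 := hlift.eventually (p := fun z => z ∈ Phat N → ∃ n ∈ N₁, mink n z = 0)
    (by simpa only [hl0] using hy)
  have e3 : ∀ᶠ η : ℝ in 𝓝[>] 0, ∀ n ∈ bad, y + η • a ∉ W n :=
    (eventually_all_finite hbadfin).2 fun n hn => eventually_notMem_submodule _ (ha n hn) y
  have e4 : ∀ᶠ z in 𝓝 y, ∀ n ∈ N₁, mink n y ≠ 0 → mink n z ≠ 0 := by
    rw [eventually_all_finite hfin]
    intro n _
    by_cases h0 : mink n y = 0
    · simp [h0]
    · have hcn : ContinuousAt (fun z => mink n z) y := by fun_prop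
      filter_upwards [hcn.eventually_ne h0] with z hz _ using hz
  have e5 := hlift.eventually (p := fun z => ∀ n ∈ N₁, mink n y ≠ 0 → mink n z ≠ 0)
    (by simpa only [hl0] using e4)
  obtain ⟨η, ⟨h1, h2, h5⟩, h3⟩ := (((e1.and (e2.and e5)).filter_mono nhdsWithin_le_nhds).and
    e3).exists
  have hzP := g.lift_mem h1
  obtain ⟨n, hn, hn0⟩ := h2 hzP
  by_cases hb : Module.finrank ℝ (Submodule.span ℝ (facet N n)) = 3
  · exact h5 n hn (hne n ⟨hn, hb⟩) hn0
  · refine h3 n ⟨hn, hb⟩ ?_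
    have hz : IsGraph.lift N (y + η • a) ∈ Submodule.span ℝ (facet N n) :=
      Submodule.subset_span ⟨hzP.1, hn0⟩
    rw [g.vert.eq_of_hor_eq (g.hor_lift h1)]
    exact Submodule.add_mem _ (Submodule.mem_sup_left hz)
      (Submodule.smul_mem _ _ (Submodule.mem_sup_right (Submodule.mem_span_singleton_self e)))

section

variable {N C : Set V} {F : Subgroup G4} {T : Set (Set V)}

theorem Presents.isFace (hP : Presents N C) {n : V} (hn : n ∈ N)
    (h3 : Module.finrank ℝ (Submodule.span ℝ (facet N n)) = 3) :
    IsFace C {x | x ∈ C ∧ mink n x = 0} := by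
  refine ⟨n, hP.pos n hn, fun x hx => (hP.mem_iff.1 hx).2.2 n hn, rfl, ?_⟩
  suffices hs : Submodule.span ℝ {x | x ∈ C ∧ mink n x = 0} = Submodule.span ℝ (facet N n) by
    rwa [hs]
  apply le_antisymm <;> rw [Submodule.span_le]
  · intro x hx
    exact Submodule.subset_span ⟨(hP.mem_iff.1 hx.1).2, hx.2⟩
  · intro x hx
    rw [← len_smul_nrm hx.1.1]
    refine Submodule.smul_mem _ _ (Submodule.subset_span ⟨hP.nrm_mem hx.1, ?_⟩)
    rw [nrm, mink_smul_right, hx.2, mul_zero]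

theorem IsConvexFuchsianPolyhedron.exists_isTriangulatedGraph
    (h : IsConvexFuchsianPolyhedron C F) (hP : Presents N C) (hT : IsTriangulation C T) :
    ∃ e, IsTriangulatedGraph N e T := by
  obtain ⟨e, g⟩ := h.exists_isGraph hP hT
  have hH3 : ∀ t ∈ T, t ⊆ H3 := fun t ht x hx => (hP.mem_iff.1 (hT.vertices t ht x hx).1).1
  have hfin : ∀ t ∈ T, t.Finite := fun t ht =>
    Set.finite_of_ncard_ne_zero (by rw [hT.three t ht]; norm_num)
  have hsubh : ∀ t ∈ T, t ⊆ hconv t := fun t ht x hx =>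
    ⟨hH3 t ht hx, 1, one_pos, by rw [one_smul]; exact subset_convexHull ℝ t hx⟩
  have hnormal : ∀ t ∈ T, ∃ n, 0 < mink n n ∧ mink n e ≠ 0 ∧ (∀ x ∈ C, mink n x ≤ 0) ∧
      hconv t ⊆ C ∧ ∀ x ∈ t, mink n x = 0 := fun t ht => by
    obtain ⟨G, ⟨n, hn, hle, hG, -⟩, htG⟩ := hT.in_face t ht
    rw [hG] at htG
    refine ⟨n, hn, ?_, hle, fun x hx => (htG hx).1, fun x hx => (htG (hsubh t ht hx)).2⟩
    have h2 := two_ne_zero_of_nonpos hn (fun u => h.mink_nonpos hP hle)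
    rcases g.unit with rfl | rfl
    · rwa [mink_e2_right]
    · rwa [mink_neg_right, mink_e2_right, neg_ne_zero]
  refine ⟨e, g, hH3, hfin, fun t ht x hx => ?_, fun t ht => ?_, fun t ht => ?_,
    fun t ht a ha x hx y hy c hc hxy => hP.vertex_eq (hT.vertices t ht a ha) hx hy hc hxy,
    fun x hx => ?_⟩
  · obtain ⟨n, hn, -, hle, htC, h0⟩ := hnormal t ht
    have hxC : x ∈ Chat N :=
      Chat_of_nrm hx.1 (hP.mem_iff.1 (htC ((nrm_mem_hconv_iff hx.1).2 hx))).2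
    -- The supporting normal `n` of the face need not belong to `N`. An interior point could still
    -- be pushed along it, violating the support inequality.
    by_contra hxP
    have hev := eventually_mem_Chat hP.fin hxC hxP
    have hmn := mink_eq_zero_of_mem_tcone h0 hx
    obtain ⟨s, hs, h1⟩ := ((((by fun_prop : ContinuousAt (fun s : ℝ => x + s • n) 0).eventually
      (p := fun y => y ∈ Chat N) (by simpa using hev)).filter_mono nhdsWithin_le_nhds).and
      (self_mem_nhdsWithin : ∀ᶠ s : ℝ in 𝓝[>] 0, s ∈ Set.Ioi 0)).exists
    have h2 := hle _ (hP.nrm_mem hs)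
    rw [nrm, mink_smul_right, mink_add_right, hmn, mink_smul_right, zero_add] at h2
    have h3 : 0 < (len (x + s • n))⁻¹ * (s * mink n n) :=
      mul_pos (inv_pos.2 (len_pos hs.1)) (mul_pos h1 hn)
    linarith
  · obtain ⟨n, -, hn, -, -, h0⟩ := hnormal t ht
    exact ⟨n, hn, h0⟩
  · obtain ⟨n, hn, hne, -, -, h0⟩ := hnormal t ht
    have hle : Submodule.span ℝ t ≤ LinearMap.ker (minkL n) :=
      Submodule.span_le.2 fun z hz => by simpa using h0 z hz
    have hrank : Module.finrank ℝ (Submodule.span ℝ t) = 3 := by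
      have := (hfin t ht).fintype
      rw [finrank_span_set_eq_card (hT.nondegenerate t ht), ← Set.ncard_eq_toFinset_card']
      exact hT.three t ht
    have heq := Submodule.eq_of_le_of_finrank_eq hle (by rw [hrank, finrank_ker_minkL hn])
    rw [eq_top_iff]
    rintro x -
    have hx : x - (mink n x / mink n e) • e ∈ Submodule.span ℝ t := by
      rw [heq, LinearMap.mem_ker, minkL_apply, mink_sub_right, mink_smul_right]
      field_simp; ring
    have := Submodule.add_mem _ (Submodule.span_mono (Set.subset_insert e t) hx)
      (Submodule.smul_mem _ (mink n x / mink n e)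
        (Submodule.subset_span (Set.mem_insert e t)))
    rwa [sub_add_cancel] at this
  · obtain ⟨N₁, hsub, hfinN, hrank, hev⟩ := g.eventually_mem_facet hx
    -- Finitely many faces matter near `x`, and each has finitely many vertices, hence finitely many
    -- triangles.
    set T₁ := {t ∈ T | ∃ n ∈ N₁, hconv t ⊆ {x | x ∈ C ∧ mink n x = 0}} with hT₁
    have hT₁fin : T₁.Finite := by
      refine (hfinN.biUnion fun n hn =>
        (h.polyhedron.2 _ (hP.isFace (hsub hn) (hrank n hn))).finite_subsets).subset ?_
      rintro t ⟨ht, n, hn, hsubt⟩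
      simp only [Set.mem_iUnion]
      exact ⟨n, hn, fun a ha => ⟨hsubt (hsubh t ht ha), hT.vertices t ht a ha⟩⟩
    have hev2 : ∀ᶠ y in 𝓝 x, ∀ t ∈ T₁, x ∉ tcone t → y ∉ tcone t := by
      rw [eventually_all_finite hT₁fin]
      intro t ht
      by_cases hxt : x ∈ tcone t
      · simp [hxt]
      · filter_upwards [eventually_notMem_tcone ((hH3 t ht.1).trans H3_subset_TL) (hfin t ht.1)
          hx.1.1 hxt] with y hy _ using hy
    refine ⟨{t ∈ T₁ | x ∈ tcone t}, fun t ht => ht.1.1, hT₁fin.subset fun t ht => ht.1,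
      fun t ht => ht.2, ?_⟩
    filter_upwards [hev, hev2] with y hy hy2 hyP
    obtain ⟨n, hn, hn0⟩ := hy hyP
    obtain ⟨t, ht, htG, hyt⟩ := hT.cover _ (hP.isFace (hsub hn) (hrank n hn)) (nrm y)
      ⟨hP.nrm_mem hyP.1, by rw [nrm, mink_smul_right, hn0, mul_zero]⟩
    have hyt' := (nrm_mem_hconv_iff hyP.1.1).1 hyt
    have htT₁ : t ∈ T₁ := ⟨ht, n, hn, htG⟩
    exact ⟨t, ⟨htT₁, by_contra fun hxt => hy2 t htT₁ hxt hyt'⟩, hyt'⟩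

end

/-! ### A discrete identity on closed curves around a vertex -/

/-- A function that is Lipschitz on each of finitely many closed sets covering an interval is
Lipschitz on the interval. -/
theorem norm_sub_le_of_closed_cover {ι E : Type*} [NormedAddCommGroup E] {A : ι → Set ℝ}
    {f : ℝ → E} {L : ℝ} (m : ℕ) : ∀ s : Finset ι, s.card = m → (∀ i ∈ s, IsClosed (A i)) →
    (∀ i ∈ s, ∀ x ∈ A i, ∀ y ∈ A i, ‖f x - f y‖ ≤ L * |x - y|) →
    ∀ a b : ℝ, a ≤ b → (∀ x ∈ Set.Icc a b, ∃ i ∈ s, x ∈ A i) → ‖f b - f a‖ ≤ L * (b - a) := by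
  classical
  induction m with
  | zero =>
    intro s hs _ _ a b hab hcov
    obtain ⟨i, hi, -⟩ := hcov a (Set.left_mem_Icc.2 hab)
    rw [Finset.card_eq_zero.1 hs] at hi
    simp at hi
  | succ m ih =>
    intro s hs hcl hL a b hab hcov
    obtain ⟨i, hi, hai⟩ := hcov a (Set.left_mem_Icc.2 hab)
    -- After the last point `c` of `A i` this set is no longer needed. The remaining sets cover `(c,
    -- b]`, and `c` as well since their union is closed.
    obtain ⟨c, ⟨hc1, hc2⟩, hmax⟩ := (isCompact_Icc.inter_left (hcl i hi)).exists_isGreatest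
      (⟨a, hai, Set.left_mem_Icc.2 hab⟩ : (A i ∩ Set.Icc a b).Nonempty)
    have h1 : ‖f c - f a‖ ≤ L * (c - a) := by
      have := hL i hi c hc1 a hai
      rwa [abs_of_nonneg (by linarith [hc2.1])] at this
    rcases hc2.2.eq_or_lt with rfl | hlt
    · exact h1
    · have hsub : ∀ x ∈ Set.Ioc c b, x ∈ ⋃ j ∈ s.erase i, A j := fun x hx => by
        obtain ⟨j, hj, hxj⟩ := hcov x ⟨hc2.1.trans hx.1.le, hx.2⟩
        simp only [Set.mem_iUnion]
        refine ⟨j, Finset.mem_erase.2 ⟨fun hji => ?_, hj⟩, hxj⟩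
        subst hji
        exact absurd (hmax ⟨hxj, hc2.1.trans hx.1.le, hx.2⟩) (not_le.2 hx.1)
      have hclosed : IsClosed (⋃ j ∈ s.erase i, A j) :=
        (s.erase i).finite_toSet.isClosed_biUnion fun j hj =>
          hcl j (Finset.mem_of_mem_erase hj)
      have hsub' : Set.Icc c b ⊆ ⋃ j ∈ s.erase i, A j := by
        rw [← closure_Ioc hlt.ne]
        exact closure_minimal hsub hclosed
      have h2 := ih (s.erase i) (by rw [Finset.card_erase_of_mem hi, hs]; rfl)
        (fun j hj => hcl j (Finset.mem_of_mem_erase hj))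
        (fun j hj => hL j (Finset.mem_of_mem_erase hj)) c b hlt.le (fun x hx => by
          simpa only [Set.mem_iUnion, exists_prop] using hsub' hx)
      calc ‖f b - f a‖ ≤ ‖f b - f c‖ + ‖f c - f a‖ := norm_sub_le_norm_sub_add_norm_sub _ _ _
        _ ≤ L * (b - a) := by linarith

theorem sum_range_shift {f : ℕ → ℝ} {n : ℕ} (hf : ∀ k, f (k + n) = f k) (m : ℕ) :
    ∑ k ∈ Finset.range n, f (k + m) = ∑ k ∈ Finset.range n, f k := by
  induction m with
  | zero => rfl
  | succ m ih =>
    rw [← ih]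
    have h1 := Finset.sum_range_succ (fun k => f (k + m)) n
    have h2 := Finset.sum_range_succ' (fun k => f (k + m)) n
    simp only [zero_add] at h2
    have h3 : f (n + m) = f m := by rw [add_comm, hf]
    have h4 : ∑ k ∈ Finset.range n, f (k + (m + 1)) = ∑ k ∈ Finset.range n, f (k + 1 + m) :=
      Finset.sum_congr rfl fun k _ => by rw [add_assoc, add_comm 1 m]
    linarith

/-- The point at angle `θ` of the ellipse with conjugate radii `p`, `q`. -/
noncomputable def circ (p q : V) (θ : ℝ) : V := Real.cos θ • p + Real.sin θ • q

theorem circ_add_add_sub (p q : V) (θ δ : ℝ) :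
    circ p q (θ + δ) + circ p q (θ - δ) = (2 * Real.cos δ) • circ p q θ := by
  ext i
  simp only [circ, Pi.add_apply, Pi.smul_apply, smul_eq_mul, Real.cos_add, Real.sin_add,
    Real.cos_sub, Real.sin_sub]
  ring

theorem circ_periodic (p q : V) (θ : ℝ) : circ p q (θ + 2 * Real.pi) = circ p q θ := by
  simp [circ]

theorem circ_between (p q : V) (θ δ D : ℝ) : Real.sin D • circ p q (θ + δ) =
    Real.sin (D - δ) • circ p q θ + Real.sin δ • circ p q (θ + D) := by
  ext i
  simp only [circ, Pi.add_apply, Pi.smul_apply, smul_eq_mul, Real.cos_add, Real.sin_add,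
    Real.sin_sub]
  ring

theorem circ_between_of_lt (p q : V) {θ δ D : ℝ} (h0 : 0 < δ) (h1 : δ ≤ D) (h2 : D < Real.pi) :
    ∃ a b : ℝ, 0 ≤ a ∧ 0 ≤ b ∧ circ p q (θ + δ) = a • circ p q θ + b • circ p q (θ + D) := by
  have hD : 0 < Real.sin D := Real.sin_pos_of_pos_of_lt_pi (by linarith) h2
  have ha : 0 ≤ Real.sin (D - δ) := Real.sin_nonneg_of_nonneg_of_le_pi (by linarith) (by linarith)
  have hb : 0 ≤ Real.sin δ := Real.sin_nonneg_of_nonneg_of_le_pi (by linarith) (by linarith)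
  refine ⟨(Real.sin D)⁻¹ * Real.sin (D - δ), (Real.sin D)⁻¹ * Real.sin δ, by positivity,
    by positivity, ?_⟩
  rw [mul_smul, mul_smul, ← smul_add, ← circ_between, smul_smul, inv_mul_cancel₀ hD.ne', one_smul]

/-- A closed polyhedral curve `y = circ + φ e` with an infinitesimal deformation `z` that is given
by infinitesimal isometries on finitely many sectors. -/
structure IsDeformedLink {ι : Type*} (p q e : V) (y z : ℝ → V) (φ : ℝ → ℝ) (s : Finset ι)
    (A : ι → V →ₗ[ℝ] V) (σ : ι → Set V) : Prop where
  eq : ∀ θ, y θ = circ p q θ + φ θ • e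
  periodic_y : ∀ θ, φ (θ + 2 * Real.pi) = φ θ
  periodic_z : ∀ θ, z (θ + 2 * Real.pi) = z θ
  cover : ∀ θ, ∃ i ∈ s, y θ ∈ σ i
  skew : ∀ i ∈ s, Skew (A i)
  deform : ∀ i ∈ s, ∀ θ, y θ ∈ σ i → z θ = A i (y θ)
  sector : ∀ i ∈ s, ∀ θ₁ θ₂ θ a b : ℝ, y θ₁ ∈ σ i → y θ₂ ∈ σ i → 0 ≤ a → 0 ≤ b →
    circ p q θ = a • circ p q θ₁ + b • circ p q θ₂ → y θ ∈ σ i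

namespace IsDeformedLink

variable {ι : Type*} {p q e : V} {y z : ℝ → V} {φ : ℝ → ℝ} {s : Finset ι}
  {A : ι → V →ₗ[ℝ] V} {σ : ι → Set V} (h : IsDeformedLink p q e y z φ s A σ)
include h

theorem y_periodic (θ : ℝ) : y (θ + 2 * Real.pi) = y θ := by
  rw [h.eq, h.eq, circ_periodic, h.periodic_y]

theorem mink_z_y (θ : ℝ) : mink (z θ) (y θ) = 0 := by
  obtain ⟨i, hi, hy⟩ := h.cover θ
  rw [h.deform i hi θ hy]; exact (h.skew i hi).self _

/-- The mixed second difference vanishes on a sector. -/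
theorem mink_sub_sub_eq_zero {i : ι} (hi : i ∈ s) {θ θ' : ℝ} (h1 : y θ ∈ σ i) (h2 : y θ' ∈ σ i) :
    mink (z θ' - z θ) (y θ' - y θ) = 0 := by
  rw [h.deform i hi θ h1, h.deform i hi θ' h2, ← map_sub]
  exact (h.skew i hi).self _

/-- Summation by parts around the circle. The terms `mink (z θ) (y θ)` vanish, and `y (θ + δ) + y (θ
- δ)` is a multiple of `y θ` plus the defect of `φ` times `e`. -/
theorem sum_mink_sub_sub {n : ℕ} {δ : ℝ} (hδ : n * δ = 2 * Real.pi) :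
    ∑ k ∈ Finset.range n, mink (z ((k + 1 : ℕ) * δ) - z (k * δ)) (y ((k + 1 : ℕ) * δ) - y (k * δ)) =
      -∑ k ∈ Finset.range n, mink (z (k * δ)) e *
        (φ (k * δ + δ) + φ (k * δ - δ) - 2 * Real.cos δ * φ (k * δ)) := by
  have hs := sum_range_shift (f := fun k => mink (z (k * δ)) (y (k * δ - δ))) (n := n)
    (fun k => by
      have e1 : ((k + n : ℕ) : ℝ) * δ = k * δ + 2 * Real.pi := by push_cast; linarith
      have e2 : k * δ + 2 * Real.pi - δ = k * δ - δ + 2 * Real.pi := by ring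
      simp only [e1, e2, h.periodic_z, h.y_periodic]) 1
  have h1 : ∀ k : ℕ, mink (z ((k + 1 : ℕ) * δ) - z (k * δ)) (y ((k + 1 : ℕ) * δ) - y (k * δ)) =
      -(mink (z ((k + 1 : ℕ) * δ)) (y ((k + 1 : ℕ) * δ - δ)) + mink (z (k * δ)) (y (k * δ + δ))) :=
    fun k => by
      have e1 : ((k + 1 : ℕ) : ℝ) * δ = k * δ + δ := by push_cast; ring
      have e2 : k * δ + δ - δ = k * δ := by ring
      rw [e1, e2, mink_sub_left, mink_sub_right, mink_sub_right, h.mink_z_y, h.mink_z_y]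
      ring
  have h2 : ∀ k : ℕ, mink (z (k * δ)) (y (k * δ - δ)) + mink (z (k * δ)) (y (k * δ + δ)) =
      mink (z (k * δ)) e * (φ (k * δ + δ) + φ (k * δ - δ) - 2 * Real.cos δ * φ (k * δ)) :=
    fun k => by
      have h3 := circ_add_add_sub p q (k * δ) δ
      have h4 : y (k * δ - δ) + y (k * δ + δ) = (2 * Real.cos δ) • y (k * δ) +
          (φ (k * δ + δ) + φ (k * δ - δ) - 2 * Real.cos δ * φ (k * δ)) • e := by
        rw [h.eq, h.eq, h.eq, smul_add, ← h3, sub_smul, add_smul, smul_smul]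
        abel
      rw [← mink_add_right, h4, mink_add_right, mink_smul_right, mink_smul_right, h.mink_z_y]
      ring
  rw [Finset.sum_congr rfl fun k _ => h1 k, Finset.sum_neg_distrib, Finset.sum_add_distrib, hs,
    ← Finset.sum_add_distrib, Finset.sum_congr rfl fun k _ => h2 k]

/-- A regular subdivision leaves each sector at most once. -/
theorem card_bad_le {n : ℕ} (hn : Odd n) {δ : ℝ} (hδ0 : 0 < δ) (hδ : n * δ = 2 * Real.pi)
    (bad : Finset ℕ) (hbad : ∀ k ∈ bad, k < n ∧
      ∀ i ∈ s, y (k * δ) ∈ σ i → y ((k + 1 : ℕ) * δ) ∉ σ i) : bad.card ≤ s.card := by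
  choose i hi hyi using fun k : ℕ => h.cover (k * δ)
  refine Finset.card_le_card_of_injOn i (fun k _ => hi k) ?_
  -- By `sector`, a later point of the same sector less than half a turn away would put the next
  -- subdivision point in it too, so `k` would not be bad.
  have key : ∀ k ∈ bad, ∀ D : ℕ, 0 < D → 2 * D < n → y (k * δ + D * δ) ∉ σ (i k) := by
    intro k hk D hD0 hDn hmem
    have hD1 : (1 : ℝ) ≤ D := by exact_mod_cast hD0
    have hDn' : (2 : ℝ) * D < n := by exact_mod_cast hDn
    obtain ⟨a, b, ha, hb, hab⟩ := circ_between_of_lt p q (θ := k * δ) (D := D * δ) hδ0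
      (by nlinarith) (by nlinarith)
    refine (hbad k hk).2 (i k) (hi k) (hyi k) ?_
    have e1 : ((k + 1 : ℕ) : ℝ) * δ = k * δ + δ := by push_cast; ring
    rw [e1]
    exact h.sector _ (hi k) _ _ _ _ _ (hyi k) hmem ha hb hab
  have main : ∀ k ∈ bad, ∀ j ∈ bad, k < j → i k ≠ i j := by
    intro k hk j hj hkj hij
    have hjn := (hbad j hj).1
    -- As `n` is odd, one of the two arcs between the points is strictly shorter than half a turn.
    rcases lt_or_ge (2 * (j - k)) n with hlt | hge
    · refine key k hk (j - k) (by omega) hlt ?_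
      have : (k : ℝ) * δ + (j - k : ℕ) * δ = j * δ := by
        rw [Nat.cast_sub hkj.le]; ring
      rw [this, hij]; exact hyi j
    · obtain ⟨r, hr⟩ := hn
      refine key j hj (k + n - j) (by omega) (by omega) ?_
      have : (j : ℝ) * δ + (k + n - j : ℕ) * δ = k * δ + 2 * Real.pi := by
        rw [Nat.cast_sub (by omega), ← hδ]; push_cast; ring
      rw [this, h.y_periodic, ← hij]; exact hyi k
  intro k hk j hj hij
  rcases lt_trichotomy k j with hlt | heq | hgt
  · exact absurd hij (main k hk j hj hlt)
  · exact heq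
  · exact absurd hij.symm (main j hj k hk hgt)

/-- The vertical component of a deformation of the link of a vertex of a concave graph is
not everywhere negative. -/
theorem false_of_neg {L c c' : ℝ} (hL : 0 ≤ L)
    (hlip : ∀ θ θ', |mink (z θ' - z θ) (y θ' - y θ)| ≤ L * (θ' - θ) ^ 2)
    (hconc : ∀ θ δ, 0 ≤ δ → δ < Real.pi / 2 → φ (θ + δ) + φ (θ - δ) ≤ 2 * Real.cos δ * φ θ)
    (hc : 0 < c) (hneg : ∀ θ, mink (z θ) e ≤ -c) (hc' : 0 < c')
    (htrip : ∀ θ, φ θ + φ (θ + 2 * Real.pi / 3) + φ (θ + 2 * (2 * Real.pi / 3)) ≤ -c') :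
    False := by
  classical
  have hpi := Real.pi_pos
  obtain ⟨j, hj⟩ := exists_nat_gt (s.card * L * Real.pi ^ 2 / (4 * c * c'))
  -- With `n = 3 * m`, a third of a turn is a whole number of steps. Taking `m` odd makes `n` odd,
  -- and `n ≥ 9` gives `δ < π / 2`.
  set m := 2 * j + 3 with hm
  set n := 3 * m with hn
  have hnodd : Odd n := ⟨3 * j + 4, by omega⟩
  have hn0 : (0 : ℝ) < n := by rw [hn]; positivity
  set δ := 2 * Real.pi / n with hδd
  have hδ : n * δ = 2 * Real.pi := by rw [hδd]; field_simp
  have hδ0 : 0 < δ := by positivity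
  have hmδ : (m : ℝ) * δ = 2 * Real.pi / 3 := by
    have : (n : ℝ) = 3 * m := by rw [hn]; push_cast; ring
    rw [this] at hδ; linarith
  have hn9 : (9 : ℝ) ≤ n := by
    have : 9 ≤ n := by omega
    exact_mod_cast this
  have hδpi : δ < Real.pi / 2 := by nlinarith
  set D : ℕ → ℝ := fun k => φ (k * δ + δ) + φ (k * δ - δ) - 2 * Real.cos δ * φ (k * δ) with hD
  have hDle : ∀ k, D k ≤ 0 := fun k => by
    have := hconc (k * δ) δ hδ0.le hδpi
    simp only [hD]; linarith
  have hper : ∀ (x : ℝ) (k : ℕ), φ ((k + n : ℕ) * δ + x) = φ (k * δ + x) := fun x k => by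
    have : ((k + n : ℕ) : ℝ) * δ + x = k * δ + x + 2 * Real.pi := by push_cast; linarith
    rw [this, h.periodic_y]
  have hshift : ∀ l : ℕ, ∑ k ∈ Finset.range n, φ (k * δ + l * δ) = ∑ k ∈ Finset.range n, φ (k * δ) :=
    fun l => by
      have := sum_range_shift (f := fun k : ℕ => φ (k * δ)) (n := n)
        (fun k => by simpa using hper 0 k) l
      rw [← this]
      refine Finset.sum_congr rfl fun k _ => ?_
      congr 1; push_cast; ring
  set S := ∑ k ∈ Finset.range n, φ (k * δ) with hS
  have hSle : 3 * S ≤ -(n * c') := by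
    have h1 : 3 * S = ∑ k ∈ Finset.range n, (φ (k * δ) + φ (k * δ + 2 * Real.pi / 3) +
        φ (k * δ + 2 * (2 * Real.pi / 3))) := by
      rw [Finset.sum_add_distrib, Finset.sum_add_distrib, ← hmδ, hshift m]
      have : ∀ k : ℕ, (k : ℝ) * δ + 2 * (m * δ) = k * δ + (2 * m : ℕ) * δ := fun k => by
        push_cast; ring
      simp only [this, hshift (2 * m)]
      ring
    rw [h1]
    calc _ ≤ ∑ k ∈ Finset.range n, -c' := Finset.sum_le_sum fun k _ => htrip _
      _ = -(n * c') := by simp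
  have hSD : ∑ k ∈ Finset.range n, D k = (2 - 2 * Real.cos δ) * S := by
    have h1 : ∑ k ∈ Finset.range n, φ (k * δ - δ) = S := by
      rw [← sum_range_shift (f := fun k : ℕ => φ (k * δ - δ)) (n := n)
        (fun k => by simpa only [sub_eq_add_neg] using hper (-δ) k) 1]
      refine Finset.sum_congr rfl fun k _ => ?_
      congr 1; push_cast; ring
    have h2 := hshift 1
    simp only [Nat.cast_one, one_mul] at h2
    simp only [hD, Finset.sum_sub_distrib, Finset.sum_add_distrib, ← Finset.mul_sum, h1, h2]
    ring
  have hsum := h.sum_mink_sub_sub hδ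
  set Q : ℕ → ℝ := fun k =>
    mink (z ((k + 1 : ℕ) * δ) - z (k * δ)) (y ((k + 1 : ℕ) * δ) - y (k * δ)) with hQ
  have hup : ∑ k ∈ Finset.range n, Q k ≤ c * ((2 - 2 * Real.cos δ) * S) := by
    rw [hsum, ← hSD, Finset.mul_sum, ← Finset.sum_neg_distrib]
    refine Finset.sum_le_sum fun k _ => ?_
    have := hneg (k * δ)
    have h1 := hDle k
    change -(mink (z (k * δ)) e * D k) ≤ c * D k
    nlinarith
  -- Steps inside a sector contribute zero by skewness. At most `s.card` steps remain, each of order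
  -- `δ ^ 2`, whereas the upper bound is at most a negative constant times `j * δ ^ 2`.
  have hlow : -(s.card * (L * δ ^ 2)) ≤ ∑ k ∈ Finset.range n, Q k := by
    set bad := (Finset.range n).filter fun k : ℕ => ∀ i ∈ s, y (k * δ) ∈ σ i →
      y ((k + 1 : ℕ) * δ) ∉ σ i with hbad
    have hcard : bad.card ≤ s.card := h.card_bad_le hnodd hδ0 hδ bad fun k hk => by
      simpa [hbad] using hk
    have hQbad : ∑ k ∈ Finset.range n, Q k = ∑ k ∈ bad, Q k := by
      refine (Finset.sum_subset (Finset.filter_subset _ _) fun k hk hkb => ?_).symm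
      have : ∃ i ∈ s, y (k * δ) ∈ σ i ∧ y ((k + 1 : ℕ) * δ) ∈ σ i := by
        by_contra hne
        push Not at hne
        exact hkb (Finset.mem_filter.2 ⟨hk, hne⟩)
      obtain ⟨i, hi, h1, h2⟩ := this
      exact h.mink_sub_sub_eq_zero hi h1 h2
    rw [hQbad]
    have h1 : ∑ k ∈ bad, -(L * δ ^ 2) ≤ ∑ k ∈ bad, Q k := Finset.sum_le_sum fun k _ => by
      have := hlip (k * δ) ((k + 1 : ℕ) * δ)
      have e1 : ((k + 1 : ℕ) : ℝ) * δ - k * δ = δ := by push_cast; ring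
      rw [e1] at this
      exact neg_le_of_abs_le this
    refine le_trans ?_ h1
    rw [Finset.sum_const, nsmul_eq_mul, mul_neg, neg_le_neg_iff]
    have : (bad.card : ℝ) ≤ s.card := by exact_mod_cast hcard
    exact mul_le_mul_of_nonneg_right this (by positivity)
  have hcos : 4 / Real.pi ^ 2 * δ ^ 2 ≤ 2 - 2 * Real.cos δ := by
    have := Real.cos_le_one_sub_mul_cos_sq (x := δ) (by rw [abs_of_pos hδ0]; linarith)
    have e1 : 4 / Real.pi ^ 2 * δ ^ 2 = 2 * (2 / Real.pi ^ 2 * δ ^ 2) := by ring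
    linarith
  have hS3 : S ≤ -(j * c') := by
    have : (n : ℝ) = 6 * j + 9 := by rw [hn, hm]; push_cast; ring
    have hj0 : (0 : ℝ) ≤ j := Nat.cast_nonneg j
    rw [this] at hSle
    nlinarith
  have hjc : 0 ≤ j * c' := by positivity
  have h1 : c * ((2 - 2 * Real.cos δ) * S) ≤ -(c * (4 / Real.pi ^ 2 * δ ^ 2 * (j * c'))) := by
    have h2 : (2 - 2 * Real.cos δ) * S ≤ (2 - 2 * Real.cos δ) * -(j * c') :=
      mul_le_mul_of_nonneg_left hS3 (le_trans (by positivity) hcos)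
    have h3 : 4 / Real.pi ^ 2 * δ ^ 2 * (j * c') ≤ (2 - 2 * Real.cos δ) * (j * c') :=
      mul_le_mul_of_nonneg_right hcos hjc
    have h4 : (2 - 2 * Real.cos δ) * S ≤ -(4 / Real.pi ^ 2 * δ ^ 2 * (j * c')) := by linarith
    have := mul_le_mul_of_nonneg_left h4 hc.le
    linarith
  have h2 : c * (4 / Real.pi ^ 2 * δ ^ 2 * (j * c')) ≤ s.card * (L * δ ^ 2) := by linarith
  have h3 : c * (4 / Real.pi ^ 2 * (j * c')) ≤ s.card * L := by
    have h5 : 0 < δ ^ 2 := by positivity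
    refine le_of_mul_le_mul_right ?_ h5
    linarith
  rw [div_lt_iff₀ (by positivity)] at hj
  have h4 : c * (4 / Real.pi ^ 2 * (j * c')) * Real.pi ^ 2 = j * (4 * c * c') := by field_simp
  have := mul_le_mul_of_nonneg_right h3 (show 0 ≤ Real.pi ^ 2 by positivity)
  linarith

end IsDeformedLink

/-! ### The maximum principle for the vertical component -/

theorem tcone_add_smul {t : Set V} {x y : V} (hx : x ∈ tcone t) (hy : y ∈ tcone t) {c : ℝ}
    (hc : 0 ≤ c) : x + c • y ∈ tcone t := by
  rcases hc.eq_or_lt with rfl | hc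
  · simpa using hx
  · exact tcone_add hx (tcone_smul hy hc)

theorem tcone_segment {t : Set V} {v w : V} {r ρ : ℝ} (hv : v ∈ tcone t) (hr : v + r • w ∈ tcone t)
    (hρ0 : 0 < ρ) (hρ : ρ ≤ r) : v + ρ • w ∈ tcone t := by
  have hr0 : 0 < r := by linarith
  have h1 := tcone_add_smul (tcone_smul hr (c := ρ / r) (by positivity)) hv (c := 1 - ρ / r)
    (by rw [sub_nonneg, div_le_one hr0]; exact hρ)
  have : (ρ / r) • (v + r • w) + (1 - ρ / r) • v = v + ρ • w := by
    rw [smul_add, smul_smul, div_mul_cancel₀ _ hr0.ne', sub_smul, one_smul]; abel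
  rwa [this] at h1

theorem exists_norm_le_mul (f : V →ₗ[ℝ] V) : ∃ c : ℝ, 0 ≤ c ∧ ∀ w, ‖f w‖ ≤ c * ‖w‖ :=
  ⟨‖LinearMap.toContinuousLinearMap f‖, norm_nonneg _,
    fun w => (LinearMap.toContinuousLinearMap f).le_opNorm w⟩

theorem abs_mink_le (x y : V) : |mink x y| ≤ 4 * (‖x‖ * ‖y‖) := by
  have h : ∀ i, |x i * y i| ≤ ‖x‖ * ‖y‖ := fun i => by
    rw [abs_mul]
    exact mul_le_mul (norm_le_pi_norm x i) (norm_le_pi_norm y i) (abs_nonneg _) (norm_nonneg _)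
  have h0 := abs_le.1 (h 0)
  have h1 := abs_le.1 (h 1)
  have h2 := abs_le.1 (h 2)
  have h3 := abs_le.1 (h 3)
  rw [abs_le, mink]
  constructor <;> linarith [h0.1, h0.2, h1.1, h1.2, h2.1, h2.2, h3.1, h3.2]

theorem norm_circ_sub_le (p q : V) (θ θ' : ℝ) :
    ‖circ p q θ' - circ p q θ‖ ≤ (‖p‖ + ‖q‖) * |θ' - θ| := by
  have h1 : |Real.cos θ' - Real.cos θ| ≤ |θ' - θ| := by
    have := Real.abs_cos_sub_cos_le θ' θ
    exact this
  have h2 : |Real.sin θ' - Real.sin θ| ≤ |θ' - θ| := by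
    have := Real.abs_sin_sub_sin_le θ' θ
    exact this
  have : circ p q θ' - circ p q θ =
      (Real.cos θ' - Real.cos θ) • p + (Real.sin θ' - Real.sin θ) • q := by
    simp only [circ, sub_smul]; abel
  rw [this]
  calc _ ≤ ‖(Real.cos θ' - Real.cos θ) • p‖ + ‖(Real.sin θ' - Real.sin θ) • q‖ := norm_add_le _ _
    _ = |Real.cos θ' - Real.cos θ| * ‖p‖ + |Real.sin θ' - Real.sin θ| * ‖q‖ := by
      rw [norm_smul, norm_smul, Real.norm_eq_abs, Real.norm_eq_abs]
    _ ≤ |θ' - θ| * ‖p‖ + |θ' - θ| * ‖q‖ := by gcongr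
    _ = _ := by ring

/-- A function on the circle that is linear on finitely many closed sectors is Lipschitz. -/
theorem exists_lipschitz_of_sectors {ι : Type*} (s : Finset ι) {p q : V} {f : ℝ → V}
    {S : ι → Set ℝ} (hS : ∀ i ∈ s, IsClosed (S i)) (hcov : ∀ θ, ∃ i ∈ s, θ ∈ S i)
    (B : ι → V →ₗ[ℝ] V) (hf : ∀ i ∈ s, ∀ θ ∈ S i, ∀ θ' ∈ S i,
      f θ' - f θ = B i (circ p q θ' - circ p q θ)) :
    ∃ L : ℝ, 0 ≤ L ∧ ∀ θ θ', ‖f θ' - f θ‖ ≤ L * |θ' - θ| := by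
  choose c hc0 hc using fun i => exists_norm_le_mul (B i)
  set L := (∑ i ∈ s, c i) * (‖p‖ + ‖q‖) with hL
  have hsum : 0 ≤ ∑ i ∈ s, c i := Finset.sum_nonneg fun i _ => hc0 i
  have key : ∀ θ θ', θ ≤ θ' → ‖f θ' - f θ‖ ≤ L * (θ' - θ) := fun θ θ' hle => by
    refine norm_sub_le_of_closed_cover s.card s rfl hS (fun i hi x hx y hy => ?_) θ θ' hle
      (fun x _ => hcov x)
    rw [hf i hi y hy x hx]
    calc _ ≤ c i * ‖circ p q x - circ p q y‖ := hc i _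
      _ ≤ (∑ i ∈ s, c i) * ((‖p‖ + ‖q‖) * |x - y|) :=
        mul_le_mul (Finset.single_le_sum (fun i _ => hc0 i) hi) (norm_circ_sub_le p q y x)
          (norm_nonneg _) hsum
      _ = L * |x - y| := by rw [hL]; ring
  refine ⟨L, by positivity, fun θ θ' => ?_⟩
  rcases le_total θ θ' with h | h
  · rw [abs_of_nonneg (by linarith)]; exact key θ θ' h
  · rw [norm_sub_rev, abs_sub_comm, abs_of_nonneg (by linarith)]; exact key θ' θ h

theorem continuous_of_norm_le {E : Type*} [NormedAddCommGroup E] {f : ℝ → E} {L : ℝ}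
    (h : ∀ θ θ', ‖f θ' - f θ‖ ≤ L * |θ' - θ|) : Continuous f := by
  refine (LipschitzWith.of_dist_le' (K := L) fun x y => ?_).continuous
  rw [dist_eq_norm, Real.dist_eq]
  exact h y x

theorem exists_le_neg_of_periodic {f : ℝ → ℝ} (hf : Continuous f)
    (hp : ∀ θ, f (θ + 2 * Real.pi) = f θ) (hneg : ∀ θ, f θ < 0) : ∃ c > 0, ∀ θ, f θ ≤ -c := by
  obtain ⟨θ₀, -, h⟩ := isCompact_Icc.exists_isMaxOn (s := Set.Icc 0 (2 * Real.pi))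
    ⟨0, by simp [Real.pi_pos.le]⟩ hf.continuousOn
  refine ⟨-f θ₀, by linarith [hneg θ₀], fun θ => ?_⟩
  obtain ⟨θ', hθ', heq⟩ := Function.Periodic.exists_mem_Ico₀ (f := f) (c := 2 * Real.pi) hp
    (by positivity) θ
  rw [heq, neg_neg]
  exact h ⟨hθ'.1, hθ'.2.le⟩

theorem circ_three (p q : V) (θ : ℝ) : circ p q θ + circ p q (θ + 2 * Real.pi / 3) +
    circ p q (θ + 2 * (2 * Real.pi / 3)) = 0 := by
  have h := circ_add_add_sub p q (θ + 2 * Real.pi / 3) (2 * Real.pi / 3)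
  have hc : Real.cos (2 * Real.pi / 3) = -(1 / 2) := by
    rw [show 2 * Real.pi / 3 = Real.pi - Real.pi / 3 by ring, Real.cos_pi_sub, Real.cos_pi_div_three]
  rw [hc, show θ + 2 * Real.pi / 3 + 2 * Real.pi / 3 = θ + 2 * (2 * Real.pi / 3) by ring,
    show θ + 2 * Real.pi / 3 - 2 * Real.pi / 3 = θ by ring,
    show (2 * -(1 / 2) : ℝ) = -1 by norm_num, neg_smul, one_smul] at h
  have : circ p q θ + circ p q (θ + 2 * Real.pi / 3) + circ p q (θ + 2 * (2 * Real.pi / 3)) =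
    (circ p q (θ + 2 * (2 * Real.pi / 3)) + circ p q θ) + circ p q (θ + 2 * Real.pi / 3) := by abel
  rw [this, h, neg_add_cancel]

/-- A homogeneous infinitesimal isometric deformation of a triangulated graph. -/
structure IsDeformation (N : Set V) (e : V) (T : Set (Set V)) (W : V → V)
    (A : Set V → V →ₗ[ℝ] V) : Prop where
  tri : IsTriangulatedGraph N e T
  skew : ∀ t ∈ T, Skew (A t)
  eq : ∀ t ∈ T, ∀ x ∈ tcone t, W x = A t x

theorem IsDeformation.sub {N : Set V} {e : V} {T : Set (Set V)} {W : V → V}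
    {A : Set V → V →ₗ[ℝ] V} (h : IsDeformation N e T W A) {B : V →ₗ[ℝ] V} (hB : Skew B) :
    IsDeformation N e T (fun x => W x - B x) (fun t => A t - B) :=
  ⟨h.tri, fun t ht => (h.skew t ht).sub hB, fun t ht x hx => by
    rw [LinearMap.sub_apply, h.eq t ht x hx]⟩

section StrictMax

variable {N : Set V} {e : V} {T : Set (Set V)} {W : V → V} {A : Set V → V →ₗ[ℝ] V}
  (h : IsDeformation N e T W A) {v : V} (hv : v ∈ Phat N)
include h hv

/-- A strict maximum of the vertical component is attained at a vertex only. -/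
theorem IsDeformation.vertex_of_strict_max (hW : W v = 0) (hle : ∀ x ∈ Phat N, mink (W x) e ≤ 0)
    (hstrict : ∀ x ∈ Phat N, mink (W x) e = 0 → ∃ c : ℝ, x = c • v) {x y : V} (hx : x ∈ Chat N)
    (hy : y ∈ Chat N) {d : ℝ} (hd : 0 < d) (hxy : d • v = x + y) :
    (∃ c : ℝ, x = c • v) ∨ ∃ c : ℝ, y = c • v := by
  obtain ⟨T₀, hsub, -, hT₀, hev⟩ := h.tri.star v hv
  obtain ⟨t, ht, htv⟩ := hev.self_of_nhds hv
  have htT := hsub ht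
  have htt := subset_tcone ((h.tri.sub_H3 t htT).trans H3_subset_TL)
  -- On `t` the vertical component is linear, nonpositive at the vertices and zero at `v`, hence
  -- zero at some vertex. Strictness makes that vertex a multiple of `v`.
  obtain ⟨a, ha, ha0⟩ := exists_eq_zero_of_mem_tcone ((minkL e).comp (A t)) (fun x hx => by
    rw [LinearMap.comp_apply, minkL_apply, mink_comm, ← h.eq t htT x (htt hx)]
    exact hle x (h.tri.sub t htT (htt hx))) htv (by
      rw [LinearMap.comp_apply, minkL_apply, ← h.eq t htT v htv, hW, mink_zero_right])
  rw [LinearMap.comp_apply, minkL_apply, mink_comm, ← h.eq t htT a (htt ha)] at ha0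
  have haP := h.tri.sub t htT (htt ha)
  obtain ⟨c, hc⟩ := hstrict a haP ha0
  have hc0 : 0 < c := by
    have h1 := haP.1.1.2
    rw [hc, Pi.smul_apply, smul_eq_mul] at h1
    exact pos_of_mul_pos_left h1 hv.1.1.2.le
  have hvert := h.tri.vertex t htT a ha x hx y hy (d * c⁻¹) (by positivity)
    (by rw [hc, smul_smul, mul_assoc, inv_mul_cancel₀ hc0.ne', mul_one, hxy])
  refine hvert.imp (fun h1 => ⟨len x * c, ?_⟩) (fun h1 => ⟨len y * c, ?_⟩)
  · rw [mul_smul, ← hc, ← h1, len_smul_nrm hx.1]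
  · rw [mul_smul, ← hc, ← h1, len_smul_nrm hy.1]

/-- There is no strict maximum of the vertical component. -/
theorem IsDeformation.false_of_strict_max (hW : W v = 0) (hle : ∀ x ∈ Phat N, mink (W x) e ≤ 0)
    (hstrict : ∀ x ∈ Phat N, mink (W x) e = 0 → ∃ c : ℝ, x = c • v) : False := by
  classical
  have g := h.tri.graph
  have hvert := g.vert
  have hvT := hv.1.1
  obtain ⟨T₀, hsub, hfin, hT₀, hev⟩ := h.tri.star v hv
  have hAv : ∀ t ∈ T₀, A t v = 0 := fun t ht => by
    rw [← h.eq t (hsub ht) v (hT₀ t ht), hW]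
  have hlv : IsGraph.lift N v = v := g.lift_eq hv rfl
  have hev' : ∀ᶠ y in 𝓝 v, y ∈ TL ∧ ∃ t ∈ T₀, IsGraph.lift N y ∈ tcone t := by
    have h1 := (g.continuousAt_lift hvT).eventually
      (p := fun y => y ∈ Phat N → ∃ t ∈ T₀, y ∈ tcone t) (by rwa [hlv])
    filter_upwards [isOpen_TL.mem_nhds hvT, h1] with y hy h2
    exact ⟨hy, h2 (g.lift_mem hy)⟩
  obtain ⟨r, hr, hball⟩ := Metric.eventually_nhds_iff.1 hev'
  set ε := r / 2 with hε
  have hε0 : 0 < ε := by positivity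
  set p : V := ε • Pi.single 0 1 with hp
  set q : V := ε • Pi.single 1 1 with hq
  set P := circ p q with hPd
  have hP0 : ∀ θ, P θ 0 = ε * Real.cos θ := fun θ => by simp [hPd, circ, hp, hq, mul_comm]
  have hP1 : ∀ θ, P θ 1 = ε * Real.sin θ := fun θ => by simp [hPd, circ, hp, hq, mul_comm]
  have hP2 : ∀ θ, P θ 2 = 0 := fun θ => by simp [hPd, circ, hp, hq]
  have hP3 : ∀ θ, P θ 3 = 0 := fun θ => by simp [hPd, circ, hp, hq]
  have hPnorm : ∀ θ, ‖P θ‖ < r := fun θ => by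
    refine lt_of_le_of_lt ((pi_norm_le_iff_of_nonneg hε0.le).2 fun i => ?_) (half_lt_self hr)
    rw [Real.norm_eq_abs]
    fin_cases i
    · change |P θ 0| ≤ ε
      rw [hP0, abs_mul, abs_of_pos hε0]
      exact mul_le_of_le_one_right hε0.le (Real.abs_cos_le_one θ)
    · change |P θ 1| ≤ ε
      rw [hP1, abs_mul, abs_of_pos hε0]
      exact mul_le_of_le_one_right hε0.le (Real.abs_sin_le_one θ)
    · change |P θ 2| ≤ ε
      rw [hP2, abs_zero]; exact hε0.le
    · change |P θ 3| ≤ ε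
      rw [hP3, abs_zero]; exact hε0.le
  have hvP : ∀ θ, v + P θ ∈ TL ∧ ∃ t ∈ T₀, IsGraph.lift N (v + P θ) ∈ tcone t := fun θ =>
    hball (by rw [dist_eq_norm, add_sub_cancel_left]; exact hPnorm θ)
  set X : ℝ → V := fun θ => IsGraph.lift N (v + P θ) with hX
  have hXP : ∀ θ, X θ ∈ Phat N := fun θ => g.lift_mem (hvP θ).1
  have hXhor : ∀ θ, hor (X θ) = hor v + P θ := fun θ => by
    rw [hX]
    simp only
    rw [g.hor_lift (hvP θ).1, hor_add, hor_of_two_eq_zero (hP2 θ)]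
  have hXne : ∀ θ (c : ℝ), X θ ≠ c • v := fun θ c heq => by
    have h1 := hXhor θ
    rw [heq, hor_smul] at h1
    have h3 := congrFun h1 3
    have hu3 : hor v 3 = v 3 := by simp [hor, e2]
    simp only [Pi.smul_apply, smul_eq_mul, Pi.add_apply, hP3, hu3, add_zero] at h3
    have hc : c = 1 := mul_right_cancel₀ hvT.2.ne' (by rw [h3, one_mul])
    rw [hc, one_smul, left_eq_add] at h1
    have e0 := congrFun h1 0
    have e1 := congrFun h1 1
    rw [hP0] at e0
    rw [hP1] at e1
    have h5 := Real.sin_sq_add_cos_sq θ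
    rw [(mul_eq_zero.1 e0).resolve_left hε0.ne', (mul_eq_zero.1 e1).resolve_left hε0.ne'] at h5
    norm_num at h5
  set y : ℝ → V := fun θ => X θ - v with hy
  set φ : ℝ → ℝ := fun θ => mink (y θ) e with hφ
  have hhory : ∀ θ, hor (y θ) = P θ := fun θ => by
    have : hor (y θ) + hor v = hor v + P θ := by
      rw [← hXhor, ← hor_add]; simp [hy]
    rw [add_comm (hor v)] at this
    exact add_right_cancel this
  have hyeq : ∀ θ, y θ = P θ + φ θ • e := fun θ => by
    conv_lhs => rw [← hvert.decomp (y θ), hhory]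
  have hXy : ∀ θ, X θ = v + (1 : ℝ) • y θ := fun θ => by simp [hy]
  have hXper : ∀ θ, X (θ + 2 * Real.pi) = X θ := fun θ => by
    simp only [hX, hPd, circ_periodic]
  -- Sectors are directions pointing into the triangle at `v`. A combination of two such directions
  -- may leave the triangle at unit length, but not after shrinking.
  set σ : Set V → Set V := fun t => {w | ∃ r : ℝ, 0 < r ∧ v + r • w ∈ tcone t} with hσ
  have hmem : ∀ θ, ∃ t ∈ T₀, v + (1 : ℝ) • y θ ∈ tcone t := fun θ => by
    obtain ⟨t, ht, h1⟩ := (hvP θ).2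
    exact ⟨t, ht, by rw [← hXy]; exact h1⟩
  have hlink : IsDeformedLink p q e y (fun θ => W (X θ)) φ hfin.toFinset A σ := by
    refine ⟨hyeq, fun θ => ?_, fun θ => ?_, fun θ => ?_, fun t ht => ?_, fun t ht θ hθ => ?_,
      fun t ht θ₁ θ₂ θ a b h1 h2 ha hb hab => ?_⟩
    · simp only [hφ, hy, hXper]
    · simp only [hXper]
    · obtain ⟨t, ht, h1⟩ := hmem θ
      exact ⟨t, hfin.mem_toFinset.2 ht, 1, one_pos, h1⟩
    · exact h.skew t (hsub (hfin.mem_toFinset.1 ht))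
    · have ht := hfin.mem_toFinset.1 ht
      obtain ⟨ρ, hρ, h1⟩ := hθ
      obtain ⟨t', ht', h2⟩ := hmem θ
      have hm0 : 0 < min ρ 1 := lt_min hρ one_pos
      have h3 := tcone_segment (hT₀ t ht) h1 hm0 (min_le_left _ _)
      have h4 := tcone_segment (hT₀ t' ht') h2 hm0 (min_le_right _ _)
      have h5 := h.eq t (hsub ht) _ h3
      rw [h.eq t' (hsub ht') _ h4, map_add, map_add, hAv t ht, hAv t' ht', zero_add, zero_add,
        map_smul, map_smul] at h5
      have h6 := smul_right_injective V hm0.ne' h5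
      change W (X θ) = _
      rw [← h6, hXy, h.eq t' (hsub ht') _ h2, map_add, hAv t' ht', zero_add, one_smul]
    · have ht := hfin.mem_toFinset.1 ht
      obtain ⟨r₁, hr₁, h1⟩ := h1
      obtain ⟨r₂, hr₂, h2⟩ := h2
      obtain ⟨t', ht', h3⟩ := hmem θ
      -- The factor `ρ` makes the coefficients of `v` add up to one, so the combination is `v` plus
      -- `ρ` times the combined direction.
      set ρ := (1 + a / r₁ + b / r₂)⁻¹ with hρ
      have hden : 0 < 1 + a / r₁ + b / r₂ := by positivity
      have hρ0 : 0 < ρ := by positivity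
      have hρ1 : ρ ≤ 1 := inv_le_one_of_one_le₀ (by
        have : 0 ≤ a / r₁ := by positivity
        have : 0 ≤ b / r₂ := by positivity
        linarith)
      have hρm : ρ * (1 + a / r₁ + b / r₂) = 1 := inv_mul_cancel₀ hden.ne'
      have h4 := tcone_segment (hT₀ t' ht') h3 hρ0 hρ1
      have h5 := tcone_add_smul (tcone_add_smul (tcone_smul (hT₀ t ht) hρ0) h1
        (c := ρ * (a / r₁)) (by positivity)) h2 (c := ρ * (b / r₂)) (by positivity)
      have h6 : ρ • v + (ρ * (a / r₁)) • (v + r₁ • y θ₁) + (ρ * (b / r₂)) • (v + r₂ • y θ₂) =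
          v + ρ • (a • y θ₁ + b • y θ₂) := by
        have e1 : ρ * (a / r₁) * r₁ = ρ * a := by field_simp
        have e2 : ρ * (b / r₂) * r₂ = ρ * b := by field_simp
        have e3 : v = (ρ + ρ * (a / r₁) + ρ * (b / r₂)) • v := by
          rw [show ρ + ρ * (a / r₁) + ρ * (b / r₂) = 1 by linarith, one_smul]
        rw [smul_add, smul_add, smul_smul, smul_smul, e1, e2, smul_add, smul_smul, smul_smul]
        conv_rhs => rw [e3]
        rw [add_smul, add_smul]
        abel
      rw [h6] at h5
      have h7 : v + ρ • y θ = v + ρ • (a • y θ₁ + b • y θ₂) := by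
        refine g.eq_of_hor_eq (h.tri.sub t' (hsub ht') h4) (h.tri.sub t (hsub ht) h5) ?_
        simp only [hor_add, hor_smul, hhory]
        rw [hPd, hab]
      refine ⟨ρ, hρ0, ?_⟩
      rw [h7]; exact h5
  have hXcont : Continuous X := continuous_iff_continuousAt.2 fun θ => by
    refine ContinuousAt.comp (g := IsGraph.lift N) (g.continuousAt_lift (hvP θ).1) ?_
    have : Continuous fun θ => v + P θ := by simp only [hPd]; unfold circ; fun_prop
    exact this.continuousAt
  choose! nv hnve hnv using h.tri.normal
  -- The projection along `e` onto the plane of `t`: it recovers differences on the surface from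
  -- differences on the circle, which gives Lipschitz bounds.
  set R : Set V → V →ₗ[ℝ] V := fun t =>
    LinearMap.id - ((mink (nv t) e)⁻¹ • minkL (nv t)).smulRight e with hR
  set S : Set V → Set ℝ := fun t => {θ | X θ ∈ tcone t} with hSd
  have hSclosed : ∀ t ∈ hfin.toFinset, IsClosed (S t) := fun t ht => by
    have ht := hsub (hfin.mem_toFinset.1 ht)
    rw [← isOpen_compl_iff, isOpen_iff_mem_nhds]
    intro θ hθ
    exact hXcont.continuousAt.eventually (eventually_notMem_tcone
      ((h.tri.sub_H3 t ht).trans H3_subset_TL) (h.tri.finite t ht) (hXP θ).1.1 hθ)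
  have hScov : ∀ θ, ∃ t ∈ hfin.toFinset, θ ∈ S t := fun θ => by
    obtain ⟨t, ht, h1⟩ := (hvP θ).2
    exact ⟨t, hfin.mem_toFinset.2 ht, h1⟩
  have hXdiff : ∀ t ∈ hfin.toFinset, ∀ θ ∈ S t, ∀ θ' ∈ S t, X θ' - X θ = R t (P θ' - P θ) := by
    intro t ht θ hθ θ' hθ'
    have ht := hsub (hfin.mem_toFinset.1 ht)
    have h1 : X θ' - X θ = P θ' - P θ + (φ θ' - φ θ) • e := by
      rw [hXy, hXy, hyeq, hyeq, sub_smul]; simp only [one_smul]; abel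
    have h2 : mink (nv t) (X θ' - X θ) = 0 := by
      rw [mink_sub_right, mink_eq_zero_of_mem_tcone (hnv t ht) hθ,
        mink_eq_zero_of_mem_tcone (hnv t ht) hθ', sub_zero]
    rw [h1, mink_add_right, mink_smul_right] at h2
    have h3 : φ θ' - φ θ = -((mink (nv t) e)⁻¹ * mink (nv t) (P θ' - P θ)) := by
      have := hnve t ht
      field_simp
      linarith
    rw [h1, h3, neg_smul, ← sub_eq_add_neg]
    rfl
  obtain ⟨L₁, hL₁, hlip₁⟩ := exists_lipschitz_of_sectors hfin.toFinset hSclosed hScov R hXdiff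
  obtain ⟨L₂, hL₂, hlip₂⟩ := exists_lipschitz_of_sectors (p := p) (q := q) (f := fun θ => W (X θ))
    hfin.toFinset hSclosed hScov (fun t => (A t).comp (R t)) (fun t ht θ hθ θ' hθ' => by
      have ht' := hsub (hfin.mem_toFinset.1 ht)
      rw [LinearMap.comp_apply, ← hPd, ← hXdiff t ht θ hθ θ' hθ', map_sub, h.eq t ht' _ hθ,
        h.eq t ht' _ hθ'])
  have hφcont : Continuous φ := by
    simp only [hφ, hy]; fun_prop
  have hWcont : Continuous fun θ => W (X θ) := continuous_of_norm_le hlip₂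
  obtain ⟨c, hc, hneg⟩ := exists_le_neg_of_periodic (f := fun θ => mink (W (X θ)) e)
    (continuous_mink hWcont continuous_const) (fun θ => by simp only [hXper]) (fun θ =>
      lt_of_le_of_ne (hle _ (hXP θ)) fun h0 => by
        obtain ⟨c, hc⟩ := hstrict _ (hXP θ) h0
        exact hXne θ c hc)
  obtain ⟨c', hc', htrip⟩ := exists_le_neg_of_periodic
    (f := fun θ => φ θ + φ (θ + 2 * Real.pi / 3) + φ (θ + 2 * (2 * Real.pi / 3)))
    (by fun_prop) (fun θ => by
      have h1 := hlink.periodic_y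
      simp only [h1, add_right_comm θ (2 * Real.pi)]) (fun θ => by
      set θ₁ := θ + 2 * Real.pi / 3
      set θ₂ := θ + 2 * (2 * Real.pi / 3)
      -- Three equally spaced circle points sum to zero, so the sum of the heights is nonpositive.
      -- Equality would split a multiple of `v` into cone elements off its ray, which a vertex
      -- forbids.
      have h1 : X θ + (X θ₁ + X θ₂) = (3 : ℝ) • v + (φ θ + φ θ₁ + φ θ₂) • e := by
        have h2 : P θ + P θ₁ + P θ₂ = 0 := circ_three p q θ
        have h3 : X θ + (X θ₁ + X θ₂) = (3 : ℝ) • v + (P θ + P θ₁ + P θ₂) +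
            (φ θ + φ θ₁ + φ θ₂) • e := by
          rw [hXy, hXy, hXy, hyeq, hyeq, hyeq]
          module
        rw [h3, h2, add_zero]
      have h12 := Chat_add (hXP θ₁).1 (hXP θ₂).1
      have h4 := Chat_add (hXP θ).1 h12
      rw [h1] at h4
      have h5 := g.not_above (Phat_smul hv three_pos) h4
      refine lt_of_le_of_ne h5 fun h0 => ?_
      change φ θ + φ θ₁ + φ θ₂ = 0 at h0
      rw [h0, zero_smul, add_zero] at h1
      rcases h.vertex_of_strict_max hv hW hle hstrict (hXP θ).1 h12 three_pos h1.symm with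
        ⟨c, hc⟩ | ⟨c, hc⟩
      · exact hXne _ _ hc
      · rw [hc] at h1
        refine hXne θ (3 - c) ?_
        rw [sub_smul, ← h1, add_sub_cancel_right])
  refine hlink.false_of_neg (L := 4 * (L₂ * L₁)) (by positivity) (fun θ θ' => ?_)
    (fun θ δ hδ0 hδ => ?_) hc hneg hc' htrip
  · refine (abs_mink_le _ _).trans ?_
    have h1 : y θ' - y θ = X θ' - X θ := by simp [hy]
    rw [h1]
    calc 4 * (‖W (X θ') - W (X θ)‖ * ‖X θ' - X θ‖) ≤ 4 * ((L₂ * |θ' - θ|) * (L₁ * |θ' - θ|)) :=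
          mul_le_mul_of_nonneg_left (mul_le_mul (hlip₂ θ θ') (hlip₁ θ θ') (norm_nonneg _)
            (by positivity)) (by norm_num)
      _ = 4 * (L₂ * L₁) * |θ' - θ| ^ 2 := by ring
      _ = _ := by rw [sq_abs]
  · have hcos0 : 0 < Real.cos δ := Real.cos_pos_of_mem_Ioo ⟨by linarith [Real.pi_pos], hδ⟩
    obtain ⟨t, ht, h1⟩ := hmem θ
    have h2 := h.tri.sub t (hsub ht) (tcone_segment (hT₀ t ht) h1 hcos0 (Real.cos_le_one δ))
    have h3 := Phat_smul h2 two_pos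
    have h4 := Chat_add (hXP (θ + δ)).1 (hXP (θ - δ)).1
    have h5 : X (θ + δ) + X (θ - δ) = (2 : ℝ) • (v + Real.cos δ • y θ) +
        (φ (θ + δ) + φ (θ - δ) - 2 * Real.cos δ * φ θ) • e := by
      have h6 : P (θ + δ) + P (θ - δ) = (2 * Real.cos δ) • P θ := circ_add_add_sub p q θ δ
      have h7 : X (θ + δ) + X (θ - δ) = (2 : ℝ) • v + (P (θ + δ) + P (θ - δ)) +
          (φ (θ + δ) + φ (θ - δ)) • e := by
        rw [hXy, hXy, hyeq, hyeq]
        module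
      rw [h7, h6, hyeq]
      module
    rw [h5] at h4
    linarith [g.not_above h3 h4]

end StrictMax

/-! ### Rigidity -/

section

variable {N : Set V} {e : V} {T : Set (Set V)} {W : V → V} {A : Set V → V →ₗ[ℝ] V}

theorem IsDeformation.neg (h : IsDeformation N e T W A) :
    IsDeformation N e T (fun x => -W x) (fun t => (-1 : ℝ) • A t) :=
  ⟨h.tri, fun t ht => (h.skew t ht).smul _, fun t ht x hx => by
    rw [h.eq t ht x hx, LinearMap.smul_apply, neg_one_smul]⟩

theorem IsDeformation.mink_self (h : IsDeformation N e T W A) {x : V} (hx : x ∈ Phat N) :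
    mink (W x) x = 0 := by
  obtain ⟨T₀, hsub, -, -, hev⟩ := h.tri.star x hx
  obtain ⟨t, ht, htx⟩ := hev.self_of_nhds hx
  rw [h.eq t (hsub ht) x htx]
  exact (h.skew t (hsub ht)).self x

/-- The ratio of the vertical component to the distance from the origin in the horizontal
projection has no positive maximum. -/
theorem IsDeformation.false_of_max (h : IsDeformation N e T W A) {m : ℝ} (hm : 0 < m) {v : V}
    (hv : v ∈ Phat N) (hv1 : mink (hor v) (hor v) = -1)
    (hmax : ∀ x ∈ Phat N, mink (W x) e ≤ m * len (hor x)) (heq : mink (W v) e = m) : False := by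
  have g := h.tri.graph
  have hvert := g.vert
  set u := hor v with hu
  have huT : u ∈ TL := hor_mem_TL hv.1.1
  have hue : mink u e = 0 := hvert.mink_hor v
  have hxu : ∀ x, mink (hor x) u = mink x u := fun x => mink_hor_left x u (hor_two v)
  have hvu : mink v u = -1 := by rw [← hxu, hv1]
  have hK0e : ∀ x, mink ((m • wedge e u) x) e = -(m * mink x u) := fun x => by
    rw [LinearMap.smul_apply, wedge_apply, mink_smul_left, mink_sub_left, mink_smul_left,
      mink_smul_left, hue, hvert.mink_self]
    ring
  have h1 := h.sub ((skew_wedge e u).smul m)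
  set W₁ := fun x => W x - (m • wedge e u) x with hW₁
  set ζ := W₁ v with hζ
  have hζe : mink ζ e = 0 := by
    rw [hζ, hW₁]
    simp only
    rw [mink_sub_left, hK0e, heq, hvu]; ring
  have hζv : mink ζ v = 0 := h1.mink_self hv
  have hζu : mink v ζ = 0 := by rw [mink_comm]; exact hζv
  have hK1e : ∀ x, mink (wedge ζ u x) e = 0 := fun x => by
    rw [wedge_apply, mink_sub_left, mink_smul_left, mink_smul_left, hue, hζe]; ring
  -- Since `v` is orthogonal to `ζ` and `mink v u = -1`, this infinitesimal isometry takes the value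
  -- `ζ` at `v`; its vertical component is zero.
  have h2 := h1.sub (skew_wedge ζ u)
  have hval : ∀ x, mink (W₁ x - wedge ζ u x) e = mink (W x) e + m * mink (hor x) u := fun x => by
    rw [mink_sub_left, hK1e, hW₁]
    simp only
    rw [mink_sub_left, hK0e, hxu]; ring
  refine h2.false_of_strict_max hv ?_ (fun x hx => ?_) (fun x hx h0 => ?_)
  · change ζ - wedge ζ u v = 0
    rw [wedge_apply, hζu, hvu, zero_smul, zero_sub, neg_one_smul, neg_neg, sub_self]
  · rw [hval]
    have := (len_le_neg_mink huT hv1 (hor_mem_TL hx.1.1)).1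
    have := hmax x hx
    nlinarith
  · rw [hval] at h0
    have h3 := len_le_neg_mink huT hv1 (hor_mem_TL hx.1.1)
    have h4 := hmax x hx
    have h5 : len (hor x) = -mink (hor x) u := by
      apply le_antisymm h3.1
      nlinarith
    have h6 := h3.2 h5
    have hc : 0 < -mink (hor x) u := h5 ▸ len_pos (hor_mem_TL hx.1.1)
    refine ⟨-mink (hor x) u, g.eq_of_hor_eq hx (Phat_smul hv hc) ?_⟩
    rw [hor_smul]; exact h6

/-- A deformation without vertical component is trivial. -/
theorem IsDeformation.eq_of_horizontal (h : IsDeformation N e T W A)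
    (h0 : ∀ x ∈ Phat N, mink (W x) e = 0) : ∃ t ∈ T, ∀ x ∈ Phat N, W x = A t x := by
  have g := h.tri.graph
  have hvert := g.vert
  have htt : ∀ t ∈ T, t ⊆ tcone t := fun t ht =>
    subset_tcone ((h.tri.sub_H3 t ht).trans H3_subset_TL)
  have hAe : ∀ t ∈ T, A t e = 0 := fun t ht => by
    refine eq_zero_of_mink_eq_zero_of_span (h.tri.span t ht) fun x hx => ?_
    rcases Set.mem_insert_iff.1 hx with rfl | hx
    · exact (h.skew t ht).self _
    · rw [h.skew t ht, mink_comm, ← h.eq t ht x (htt t ht hx),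
        h0 x (h.tri.sub t ht (htt t ht hx)), neg_zero]
  have hAhor : ∀ t ∈ T, ∀ x, A t x = A t (hor x) := fun t ht x => by
    conv_lhs => rw [← hvert.decomp x]
    rw [map_add, map_smul, hAe t ht, smul_zero, add_zero]
  set ξ : V → V := fun q => W (IsGraph.lift N q) with hξ
  have hξA : ∀ t ∈ T, ∀ q ∈ TL, IsGraph.lift N q ∈ tcone t → ξ q = A t (hor q) :=
    fun t ht q hq hqt => by
      rw [hξ]
      simp only
      rw [h.eq t ht _ hqt, hAhor t ht, g.hor_lift hq]
  have hloc : ∀ q ∈ TL, ∀ᶠ q' in 𝓝 q, q' ∈ TL ∧ ∃ t ∈ T, ξ q = A t (hor q) ∧ ξ q' = A t (hor q') :=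
    fun q hq => by
      obtain ⟨T₀, hsub, -, hT₀, hev⟩ := h.tri.star _ (g.lift_mem hq)
      filter_upwards [isOpen_TL.mem_nhds hq, (g.continuousAt_lift hq).eventually hev] with q' h1 h2
      obtain ⟨t, ht, h3⟩ := h2 (g.lift_mem h1)
      exact ⟨h1, t, hsub ht, hξA t (hsub ht) q hq (hT₀ t ht), hξA t (hsub ht) q' h1 h3⟩
  have hself : ∀ q ∈ TL, mink (ξ q) (hor q) = 0 := fun q hq => by
    obtain ⟨-, t, ht, h1, -⟩ := (hloc q hq).self_of_nhds
    rw [h1]; exact (h.skew t ht).self _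
  -- Infinitesimal rigidity of segments: the velocity component along a straight segment is constant
  -- on each piece with one skew map, and nearby points share such a map.
  have hconst : ∀ q₀ ∈ TL, ∀ q₁ ∈ TL,
      mink (ξ q₀) (hor q₁ - hor q₀) = mink (ξ q₁) (hor q₁ - hor q₀) := by
    intro q₀ hq₀ q₁ hq₁
    set d := hor q₁ - hor q₀ with hd
    set Q : ℝ → V := fun τ => (1 - τ) • q₀ + τ • q₁ with hQ
    have hQT : ∀ τ ∈ Set.Icc (0 : ℝ) 1, Q τ ∈ TL := fun τ hτ =>
      convex_TL hq₀ hq₁ (by linarith [hτ.2]) hτ.1 (by ring)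
    have hQd : ∀ τ τ', hor (Q τ') - hor (Q τ) = (τ' - τ) • d := fun τ τ' => by
      simp only [hQ, hd, hor_add, hor_smul]; module
    have := (isPreconnected_Icc (a := (0 : ℝ)) (b := 1)).induction₂'
      (fun τ τ' => mink (ξ (Q τ)) d = mink (ξ (Q τ')) d) (fun τ hτ => by
        have hc : ContinuousAt Q τ := by
          have : Continuous Q := by fun_prop
          exact this.continuousAt
        filter_upwards [(hc.eventually (hloc _ (hQT τ hτ))).filter_mono nhdsWithin_le_nhds]
          with τ' hτ'
        obtain ⟨-, t, ht, h1, h2⟩ := hτ'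
        have h3 : mink (ξ (Q τ)) d = mink (ξ (Q τ')) d := by
          rw [h1, h2, eq_comm, ← sub_eq_zero, ← mink_sub_left, ← map_sub, hQd, map_smul,
            mink_smul_left, (h.skew t ht).self, mul_zero]
        exact ⟨h3, h3.symm⟩) (fun _ _ _ _ _ _ h1 h2 => h1.trans h2)
      (Set.left_mem_Icc.2 zero_le_one) (Set.right_mem_Icc.2 zero_le_one)
    simpa [hQ] using this
  have hskew : ∀ q₀ ∈ TL, ∀ q₁ ∈ TL, mink (ξ q₀) (hor q₁) = -mink (ξ q₁) (hor q₀) :=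
    fun q₀ h₀ q₁ h₁ => by
      have := hconst q₀ h₀ q₁ h₁
      rw [mink_sub_right, mink_sub_right, hself q₀ h₀, hself q₁ h₁] at this
      linarith
  obtain ⟨x₀, hx₀⟩ := g.nonempty
  obtain ⟨T₀, hsub, -, -, hev⟩ := h.tri.star x₀ hx₀
  obtain ⟨t, ht, -⟩ := hev.self_of_nhds hx₀
  have ht := hsub ht
  refine ⟨t, ht, fun x hx => ?_⟩
  have hexp : ∀ w y, mink w e = 0 → mink w y = mink w (hor y) := fun w y hw => by
    conv_lhs => rw [← hvert.decomp y]
    rw [mink_add_right, mink_smul_right, hw, mul_zero, add_zero]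
  have hAte : ∀ y, mink (A t y) e = 0 := fun y => by
    rw [h.skew t ht, hAe t ht, mink_zero_right, neg_zero]
  have hξx : ∀ y ∈ Phat N, ξ y = W y := fun y hy => by
    rw [hξ]; simp only; rw [g.lift_eq hy rfl]
  -- It is enough to test against `e` and the vertices of one triangle. On the vertices the global
  -- antisymmetry `hskew` turns `W x` into the skew map of that triangle.
  refine sub_eq_zero.1 (eq_zero_of_mink_eq_zero_of_span (h.tri.span t ht) fun a ha => ?_)
  rcases Set.mem_insert_iff.1 ha with rfl | ha
  · rw [mink_sub_left, h0 x hx, hAte, sub_zero]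
  · have haP := h.tri.sub t ht (htt t ht ha)
    have h1 := hskew x hx.1.1 a haP.1.1
    rw [hξx x hx, hξx a haP, ← hexp _ a (h0 x hx), h.eq t ht a (htt t ht ha), ← hexp _ x (hAte a),
      h.skew t ht, neg_neg, mink_comm a] at h1
    rw [mink_sub_left, h1, sub_self]

end

/-! ### Fuchsian deformations -/

section

variable {N C : Set V} {F : Subgroup G4} {T : Set (Set V)} {Z : V → V} {K : Set V → V → V}

/-- The homogeneous extension of an infinitesimal isometric deformation. -/
theorem IsTriangulatedGraph.exists_isDeformation {e : V} (hT : IsTriangulatedGraph N e T)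
    (hK : ∀ t ∈ T, IsKilling (K t)) (hZ : ∀ t ∈ T, ∀ x ∈ hconv t, Z x = K t x) :
    ∃ A : Set V → V →ₗ[ℝ] V, IsDeformation N e T (fun x => len x • Z (nrm x)) A ∧
      ∀ t ∈ T, ∀ x ∈ H3, K t x = A t x := by
  choose! A hA hKA using fun t ht => (hK t ht).exists_skew
  refine ⟨A, ⟨hT, hA, fun t ht x hx => ?_⟩, hKA⟩
  rw [hZ t ht _ ((nrm_mem_hconv_iff hx.1).2 hx), hKA t ht _ (nrm_mem_H3 hx.1), ← map_smul,
    len_smul_nrm hx.1]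

/-- All triangles of the finite star contain `x`, so each nearby value is compared with `W x`
through a single linear map. -/
theorem IsDeformation.continuousOn {e : V} {W : V → V} {A : Set V → V →ₗ[ℝ] V}
    (h : IsDeformation N e T W A) : ContinuousOn W (Phat N) := by
  intro x hx
  obtain ⟨T₀, hsub, hfin, hT₀, hev⟩ := h.tri.star x hx
  choose c hc0 hc using fun t => exists_norm_le_mul (A t)
  refine tendsto_iff_norm_sub_tendsto_zero.2 (squeeze_zero_norm'
    (a := fun y => (∑ t ∈ hfin.toFinset, c t) * ‖y - x‖) ?_ ?_)
  · filter_upwards [hev.filter_mono nhdsWithin_le_nhds, self_mem_nhdsWithin] with y hy hyP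
    obtain ⟨t, ht, hyt⟩ := hy hyP
    rw [norm_norm, h.eq t (hsub ht) y hyt, h.eq t (hsub ht) x (hT₀ t ht), ← map_sub]
    refine (hc t _).trans (mul_le_mul_of_nonneg_right ?_ (norm_nonneg _))
    exact Finset.single_le_sum (fun t _ => hc0 t) (hfin.mem_toFinset.2 ht)
  · have : Continuous fun y => (∑ t ∈ hfin.toFinset, c t) * ‖y - x‖ := by fun_prop
    have := this.tendsto x
    rw [sub_self, norm_zero, mul_zero] at this
    exact this.mono_left nhdsWithin_le_nhds

theorem IsVertical.abs_mink {e : V} (he : IsVertical e) (x : V) : |mink x e| = |x 2| := by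
  rw [← sq_eq_sq_iff_abs_eq_abs]; exact he.mink_sq x

/-- The vertical component of a Fuchsian deformation vanishes. -/
theorem IsConvexFuchsianPolyhedron.vertical_eq_zero (h : IsConvexFuchsianPolyhedron C F)
    (hP : Presents N C) {e : V} {A : Set V → V →ₗ[ℝ] V}
    (hD : IsDeformation N e T (fun x => len x • Z (nrm x)) A) {L : F → V → V}
    (hL : ∀ f, IsFuchsianKilling (L f))
    (hLZ : ∀ f : F, ∀ y ∈ boundary C, Z (act f y) = act f (L f y + Z y)) :
    ∀ x ∈ Phat N, mink (len x • Z (nrm x)) e = 0 := by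
  have hvert := hD.tri.graph.vert
  set W := fun x => len x • Z (nrm x) with hW
  have hWZ : ∀ x ∈ H3, W x = Z x := fun x hx => by
    simp only [hW, len_eq_one hx, nrm_of_mem_H3 hx, one_smul]
  -- The absolute value makes the ratio invariant even when an element of the group sends `e2` to
  -- `-e2`.
  set ψ : V → ℝ := fun x => |W x 2| / len (hor x) with hψ
  have hinv : ∀ f ∈ F, ∀ x ∈ boundary C, ψ (act f x) = ψ x := fun f hf x hx => by
    have hxH := (hP.mem_boundary_iff.1 hx).1
    have hfx := h.act_mem_boundary hf hx
    have h1 : len (hor (act f x)) = len (hor x) := by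
      rw [len, len, mink_hor_hor, mink_hor_hor, h.group.mink_act hf, ← sq_abs (act f x 2),
        h.group.abs_act_two hf, sq_abs]
    have h2 := hLZ ⟨f, hf⟩ x hx
    simp only at h2
    simp only [hψ]
    rw [h1, hWZ x hxH, hWZ _ (hP.mem_boundary_iff.1 hfx).1, h2, h.group.abs_act_two hf,
      Pi.add_apply, (hL ⟨f, hf⟩).two_eq_zero hxH, zero_add]
  obtain ⟨B, hBsub, hB, hcov⟩ := h.cocompact
  have hBne : B.Nonempty := by
    obtain ⟨x, hx⟩ := h.connected.nonempty
    obtain ⟨f, -, hfB⟩ := hcov x hx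
    exact ⟨_, hfB⟩
  have hBP : B ⊆ Phat N := fun x hx => (hP.mem_boundary_iff.1 (hBsub hx)).2
  have hψc : ContinuousOn ψ B := by
    have h1 : ContinuousOn (fun x => W x 2) B :=
      (continuous_apply 2).comp_continuousOn (hD.continuousOn.mono hBP)
    refine h1.abs.div (by fun_prop) fun x hx => ?_
    exact (len_pos (hor_mem_TL (hBP hx).1.1)).ne'
  obtain ⟨x₁, hx₁B, hx₁⟩ := hB.exists_isMaxOn hBne hψc
  set m := ψ x₁ with hm
  have hmax : ∀ x ∈ Phat N, |mink (W x) e| ≤ m * len (hor x) := fun x hx => by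
    have hxb := hP.nrm_mem_boundary hx
    obtain ⟨f, hf, hfB⟩ := hcov _ hxb
    have h1 : ψ (nrm x) ≤ m := by rw [← hinv f hf _ hxb]; exact hx₁ hfB
    have hl := len_pos hx.1.1
    have h2 : len (hor x) = len x * len (hor (nrm x)) := by
      rw [← len_smul hl.le, ← hor_smul, len_smul_nrm hx.1.1]
    rw [hψ] at h1
    simp only at h1
    rw [div_le_iff₀ (len_pos (hor_mem_TL (nrm_mem_Chat hx.1).1)), hWZ _ (nrm_mem_H3 hx.1.1)] at h1
    rw [hvert.abs_mink, hW]
    simp only [Pi.smul_apply, smul_eq_mul]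
    rw [abs_mul, abs_of_pos hl, h2]
    calc _ ≤ len x * (m * len (hor (nrm x))) := mul_le_mul_of_nonneg_left h1 hl.le
      _ = _ := by ring
  have hx₁P := hBP hx₁B
  have hx₁T := hor_mem_TL hx₁P.1.1
  have hl₁ := len_pos hx₁T
  have hm0 : 0 ≤ m := by rw [hm, hψ]; positivity
  rcases hm0.eq_or_lt with hm0 | hm0
  · intro x hx
    have := hmax x hx
    rw [← hm0, zero_mul] at this
    exact abs_eq_zero.1 (le_antisymm this (abs_nonneg _))
  · exfalso
    set v := (len (hor x₁))⁻¹ • x₁ with hv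
    have hvP : v ∈ Phat N := Phat_smul hx₁P (inv_pos.2 hl₁)
    have hv1 : mink (hor v) (hor v) = -1 := by
      rw [hv, hor_smul]
      exact (nrm_mem_H3 hx₁T).1
    have hWv : |mink (W v) e| = m := by
      have : W v = (len (hor x₁))⁻¹ • W x₁ := by
        simp only [hW, hv]
        rw [len_smul (inv_pos.2 hl₁).le, nrm_smul (inv_pos.2 hl₁), mul_smul]
      rw [hvert.abs_mink, this, Pi.smul_apply, smul_eq_mul, abs_mul, abs_of_pos (inv_pos.2 hl₁), hm,
        hψ]
      simp only
      rw [div_eq_inv_mul]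
    -- A negative extremum becomes a positive maximum for the opposite deformation.
    rcases abs_choice (mink (W v) e) with h1 | h1
    · exact hD.false_of_max hm0 hvP hv1 (fun x hx => (le_abs_self _).trans (hmax x hx))
        (h1.symm.trans hWv)
    · refine hD.neg.false_of_max hm0 hvP hv1 (fun x hx => ?_) ?_
      · rw [mink_neg_left]
        exact (neg_le_abs _).trans (hmax x hx)
      · rw [mink_neg_left]
        exact h1.symm.trans hWv

end

end FuchsianPolyhedra

theorem theorem4 (C : Set FuchsianPolyhedra.V) (F : Subgroup FuchsianPolyhedra.G4)
    (h : FuchsianPolyhedra.IsConvexFuchsianPolyhedron C F) :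
    FuchsianPolyhedra.IsFuchsianInfinitesimallyRigid C F := by
  rintro Z ⟨⟨T, hT, K, hK, hZ⟩, L, hL, hLZ⟩
  obtain ⟨N, hP⟩ := h.polyhedron.exists_presents
  obtain ⟨e, hTG⟩ := h.exists_isTriangulatedGraph hP hT
  obtain ⟨A, hD, hKA⟩ := hTG.exists_isDeformation hK hZ
  obtain ⟨t, ht, hA⟩ := hD.eq_of_horizontal (h.vertical_eq_zero hP hD hL hLZ)
  refine ⟨K t, hK t ht, fun x hx => ?_⟩
  obtain ⟨hxH, hxP⟩ := hP.mem_boundary_iff.1 hx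
  have := hA x hxP
  rw [FuchsianPolyhedra.len_eq_one hxH, FuchsianPolyhedra.nrm_of_mem_H3 hxH, one_smul] at this
  rw [this, hKA t ht x hxH]
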